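/- Let $q:\mathbb S^2\to\mathbb R^3$ be an injective $C^\infty$ immersion of the unit sphere with image $\Gamma=q(\mathbb S^2)$. Let $[\mathbf D_{\mathbb S^2}q(\hat x)]=t_1\otimes e_\theta+t_2\otimes e_\varphi$ be the matrix that annihilates $\hat x$ and maps the orthonormal tangent vectors $e_\theta,e_\varphi$ of $\mathbb S^2$ (with $e_\theta\times e_\varphi=\hat x$) to the derivatives $t_1,t_2$ of $q$ in these directions. Put $J_q=|t_1\times t_2|$ (which vanishes nowhere), let $\nu$ be the unit normal field on $\Gamma$ with $\nu\circ q=(t_1\times t_2)/J_q$, and let $ds$ be surface measure, so that $\int_\Gamma f\,ds=\int_{\mathbb S^2}(f\circ q)\,J_q\,ds$. Let $\kappa>0$ (the shear wavenumber $\kappa_{\mathfrak s}$) and $\Phi(x,y)=\dfrac{e^{i\kappa|x-y|}}{4\pi|x-y|}$. For a continuous tangential field $g:\Gamma\to\mathbb C^3$ (that is, $\nu\cdot g=0$), let $Ag(z)=\int_\Gamma\Phi(z,y)g(y)\,ds(y)$ for $z\notin\Gamma$ and $$(Ng)(x)=2\,\nu(x)\cdot\mathbf{curl}_x\int_\Gamma\Phi(x,y)g(y)\,ds(y)=\lim_{h\to0,\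 h\ne0}2\,\nu(x)\cdot(\mathbf{curl}\,Ag)(x+h\nu(x)),\qquad x\in\Gamma;$$ we say that $Ng$ exists if this two-sided limit exists uniformly in $x\in\Gamma$. With $G=g\circ q$ let $$(\mathcal S^{\mathfrak s}G)(\hat x)=\int_{\mathbb S^2}\Big(\frac{1}{|\hat x-\hat y|}\widetilde S_1(\hat x,\hat y)+\widetilde S_2(\hat x,\hat y)\Big)G(\hat y)\,ds(\hat y),$$ $$\widetilde S_1(\hat x,\hat y)=\frac{|\hat x-\hat y|}{|q(\hat x)-q(\hat y)|}\,\frac{\cos(\kappa|q(\hat x)-q(\hat y)|)}{2\pi}\,J_q(\hat y),\qquad \widetilde S_2(\hat x,\hat y)=\frac{i\sin(\kappa|q(\hat x)-q(\hat y)|)}{2\pi|q(\hat x)-q(\hat y)|}\,J_q(\hat y),$$ where the last fraction is read as $i\kappa/(2\pi)$ for $\hat x=\hat y$. For $\varphi:\mathbb S^2\to\mathbb C$ let $\mathbf{curl}_{\mathbb S^2}\varphi=(\mathbf{Grad}_{\mathbb S^2}\varphi)\times\hat x$. **Theorem.** (i) $Ng$ exists for every tangential field $g$ on $\Gamma$ that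 is Hölder continuous with some exponent $\alpha\in(0,1]$. (ii) For every continuous tangential field $g$ on $\Gamma$, the integral defining $Ag(z)$ converges absolutely and $Ag$ is differentiable at $z$, for every $z\notin\Gamma$; and the integral defining $(\mathcal S^{\mathfrak s}G)(\hat x)$ converges absolutely for every $\hat x\in\mathbb S^2$. (iii) For every continuous tangential field $g$ on $\Gamma$ for which $Ng$ exists, and every $C^\infty$ function $\varphi:\mathbb S^2\to\mathbb C$, $$\int_{\mathbb S^2}J_q(\hat x)\,(Ng)(q(\hat x))\,\overline{\varphi(\hat x)}\,ds(\hat x)=\int_{\mathbb S^2}(\mathcal S^{\mathfrak s}G)(\hat x)\cdot\overline{[\mathbf D_{\mathbb S^2}q(\hat x)]\,\mathbf{curl}_{\mathbb S^2}\varphi(\hat x)}\,ds(\hat x),$$ that is, $\big(J_q\,(Ng)\circ q,\varphi\big)=\big(\mathcal S^{\mathfrak s}G,[\mathbf D_{\mathbb S^2}q]\,\mathbf{curl}_{\mathbb S^2}\varphi\big)$ in the $L^2$ inner product on $\mathbb S^2$; both integrands are integrable. -/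

import Mathlib

open Set Filter Topology MeasureTheory
open scoped Matrix Manifold ContDiff ComplexConjugate

namespace SphereBIE

/-- Euclidean space `ℝ³`. -/
abbrev E3 := EuclideanSpace ℝ (Fin 3)

/-- The unit sphere `𝕊²` in `ℝ³`, with Mathlib's smooth structure. -/
abbrev S2 := Metric.sphere (0 : E3) 1

/-- Smooth (`C^∞`) functions on the sphere with values in a real normed space. -/
def IsSmooth {F : Type*} [NormedAddCommGroup F] [NormedSpace ℝ F] (f : S2 → F) : Prop :=
  ContMDiff (𝓡 2) 𝓘(ℝ, F) ∞ f

/-- Complex vectors with three components. -/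
abbrev C3 := Fin 3 → ℂ

/-- A real vector regarded as a complex vector. -/
def cvec (v : E3) : C3 := fun i => (v i : ℂ)

/-- The radially constant extension `x ↦ f (x / |x|)` of a function on the sphere. -/
noncomputable def radialExt {F : Type*} [Zero F] (f : S2 → F) (x : E3) : F :=
  if h : x = 0 then 0
  else f ⟨‖x‖⁻¹ • x, by simp [norm_smul, inv_mul_cancel₀ (norm_ne_zero_iff.mpr h)]⟩

/-- The surface measure `ds` on the unit sphere (total mass `4 π`). -/
noncomputable def dsS2 : Measure S2 := (volume : Measure E3).toSphere

/-- The `3 × 3` matrix `[D_{𝕊²} q(x̂)]`. It is the derivative of the radially constant extension of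
`q`: it sends a tangent vector of the sphere to the derivative of `q` in that direction, and it
sends `x̂` to `0`, so that it equals `t₁ ⊗ e_θ + t₂ ⊗ e_φ` with `t₁ = ∂_θ q`,
`t₂ = (1 / sin θ) ∂_φ q`. -/
noncomputable def DS2 (q : S2 → E3) (x : S2) : Matrix (Fin 3) (Fin 3) ℝ :=
  Matrix.of fun i j => (fderiv ℝ (radialExt q) (x : E3) (EuclideanSpace.single j 1)) i

/-- The vector `t₁ × t₂`, written without coordinates as the cofactor matrix of `[D_{𝕊²} q(x̂)]`
applied to `x̂ = e_θ × e_φ`; see `areaVec_eq_cross`. -/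
noncomputable def areaVec (q : S2 → E3) (x : S2) : E3 :=
  WithLp.toLp 2 ((DS2 q x).adjugateᵀ *ᵥ (x : E3).ofLp)

/-- For tangent vectors `a`, `b` at `x̂` with `a × b = x̂` (such as `e_θ`, `e_φ`), the vector
`areaVec q x̂` is the cross product of the derivatives of `q` along `a` and `b`. -/
theorem areaVec_eq_cross (q : S2 → E3) (x : S2) (a b : Fin 3 → ℝ)
    (hab : a ⨯₃ b = (x : E3).ofLp) :
    (areaVec q x).ofLp = (DS2 q x *ᵥ a) ⨯₃ (DS2 q x *ᵥ b) := by
  unfold areaVec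
  rw [← hab]
  generalize DS2 q x = M
  ext i
  fin_cases i <;>
    simp [Matrix.adjugate_fin_three, cross_apply, Matrix.mulVec, dotProduct, Fin.sum_univ_three] <;> ring

/-- The Jacobian `J_q = |t₁ × t₂|`. -/
noncomputable def jac (q : S2 → E3) (x : S2) : ℝ := ‖areaVec q x‖

/-- A smooth bijective parametrization of the closed surface `Γ = range q` by the sphere. -/
structure IsParametrization (q : S2 → E3) : Prop where
  smooth : IsSmooth q
  injective : Function.Injective q
  jac_ne_zero : ∀ x, jac q x ≠ 0

/-- The unit normal field `ν` on `Γ = range q`, determined by `ν ∘ q = (t₁ × t₂) / J_q`. -/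
noncomputable def normal (q : S2 → E3) : E3 → E3 :=
  Function.extend q (fun x => (jac q x)⁻¹ • areaVec q x) 0

/-- The surface measure `ds` of `Γ = range q`, i.e. `∫_Γ f ds = ∫_{𝕊²} f(q(x̂)) J_q(x̂) ds(x̂)`. -/
noncomputable def surfaceMeasure (q : S2 → E3) : Measure E3 :=
  (dsS2.withDensity fun x => ENNReal.ofReal (jac q x)).map q

/-- The fundamental solution `Φ(x, y; κ) = exp(i κ |x - y|) / (4 π |x - y|)`. -/
noncomputable def Phi (κ : ℝ) (x y : E3) : ℂ :=
  (1 / (4 * (Real.pi : ℂ))) * (Complex.exp (Complex.I * κ * (‖x - y‖ : ℂ)) / (‖x - y‖ : ℂ))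

/-- The vector potential `A g (z) = ∫_Γ Φ(z, y; κ) g(y) ds(y)`. -/
noncomputable def vecPotential (q : S2 → E3) (κ : ℝ) (g : E3 → C3) (z : E3) : C3 :=
  ∫ y, Phi κ z y • g y ∂(surfaceMeasure q)

/-- The partial derivative `∂_j W_i (z)` of a complex vector field on `ℝ³`. -/
noncomputable def pd (W : E3 → C3) (z : E3) (j i : Fin 3) : ℂ :=
  fderiv ℝ W z (EuclideanSpace.single j 1) i

/-- The curl of a complex vector field on `ℝ³`. -/
noncomputable def curl (W : E3 → C3) (z : E3) : C3 :=
  ![pd W z 1 2 - pd W z 2 1, pd W z 2 0 - pd W z 0 2, pd W z 0 1 - pd W z 1 0]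

/-- `2 ν(x) · curl A g (x + h ν(x))`: the normal component of the curl of twice the vector
potential, at signed distance `h ≠ 0` from the surface along the normal at `x ∈ Γ`. -/
noncomputable def NOff (q : S2 → E3) (κ : ℝ) (g : E3 → C3) (h : ℝ) (x : E3) : ℂ :=
  2 * (cvec (normal q x) ⬝ᵥ curl (vecPotential q κ g) (x + h • normal q x))

/-- The operator `(N g)(x) = 2 ν(x) · curl_x ∫_Γ Φ(x, y; κ) g(y) ds(y)` for `x ∈ Γ`. The curl is
that of the potential off the surface, and its normal component at `x` is the limit from both
sides along the normal. -/
noncomputable def N (q : S2 → E3) (κ : ℝ) (g : E3 → C3) (x : E3) : ℂ :=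
  limUnder (𝓝[≠] (0 : ℝ)) fun h => NOff q κ g h x

/-- `N g` exists: the limit defining it exists, uniformly on `Γ`. -/
def NExists (q : S2 → E3) (κ : ℝ) (g : E3 → C3) : Prop :=
  TendstoUniformlyOn (NOff q κ g) (N q κ g) (𝓝[≠] (0 : ℝ)) (range q)

/-- Continuous tangential vector fields on `Γ = range q` (values off `Γ` are irrelevant). -/
def IsContTangential (q : S2 → E3) (g : E3 → C3) : Prop :=
  ContinuousOn g (range q) ∧ ∀ x ∈ range q, cvec (normal q x) ⬝ᵥ g x = 0

/-- `s₁(x, y) = cos(κ |x - y|) / (2 π)`. -/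
noncomputable def s1 (κ : ℝ) (x y : E3) : ℂ :=
  Complex.cos (κ * (‖x - y‖ : ℂ)) / (2 * (Real.pi : ℂ))

open Classical in
/-- `s₂(x, y) = i sin(κ |x - y|) / (2 π |x - y|)`, extended by its limit to `x = y`. -/
noncomputable def s2 (κ : ℝ) (x y : E3) : ℂ :=
  if x = y then Complex.I * κ / (2 * (Real.pi : ℂ))
  else Complex.I * Complex.sin (κ * (‖x - y‖ : ℂ)) / (2 * (Real.pi : ℂ) * (‖x - y‖ : ℂ))

/-- `R(x̂, ŷ) = |x̂ - ŷ| / |q(x̂) - q(ŷ)|`. -/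
noncomputable def R (q : S2 → E3) (x y : S2) : ℝ := ‖(x : E3) - (y : E3)‖ / ‖q x - q y‖

/-- The kernel `(1 / |x̂ - ŷ|) S̃₁(x̂, ŷ) + S̃₂(x̂, ŷ)` of the parametrized single-layer operator,
with `S̃₁(x̂, ŷ) = R(x̂, ŷ) s₁(q(x̂), q(ŷ)) J_q(ŷ)` and `S̃₂(x̂, ŷ) = s₂(q(x̂), q(ŷ)) J_q(ŷ)`. -/
noncomputable def singleLayerKernel (q : S2 → E3) (κ : ℝ) (x y : S2) : ℂ :=
  (1 / (‖(x : E3) - (y : E3)‖ : ℂ)) * ((R q x y : ℂ) * s1 κ (q x) (q y) * (jac q y : ℂ))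
    + s2 κ (q x) (q y) * (jac q y : ℂ)

/-- The parametrized single-layer operator `𝒮 G` on vector fields `G : 𝕊² → ℂ³`. -/
noncomputable def singleLayer (q : S2 → E3) (κ : ℝ) (G : S2 → C3) (x : S2) : C3 :=
  ∫ y, singleLayerKernel q κ x y • G y ∂dsS2

/-- The surface gradient `Grad_{𝕊²} φ`: the gradient of the radially constant extension. -/
noncomputable def gradS2 (φ : S2 → ℂ) (x : S2) : C3 :=
  fun i => fderiv ℝ (radialExt φ) (x : E3) (EuclideanSpace.single i 1)

/-- The surface vector curl `curl_{𝕊²} φ = (Grad_{𝕊²} φ) × x̂`. -/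
noncomputable def curlS2 (φ : S2 → ℂ) (x : S2) : C3 :=
  gradS2 φ x ⨯₃ cvec (x : E3)

/-- The tangential field `[D_{𝕊²} q] curl_{𝕊²} φ`. -/
noncomputable def DcurlS2 (q : S2 → E3) (φ : S2 → ℂ) (x : S2) : C3 :=
  (DS2 q x).map (fun r : ℝ => (r : ℂ)) *ᵥ curlS2 φ x

end SphereBIE

/-! The identity is Stokes' theorem on the parallel surfaces `shift q h`, that is `q + h ν`,
followed by `h → 0`. For small `h ≠ 0` the parallel surface stays away from `Γ`, so the potential
`Ag` is `C¹` near it and `stokes` gives `∫ (area vector · curl Ag) ψ = ∫ Ag · [D] curl ψ` there.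
Three facts control the limit.

The area vector of the parallel surface is `J_q ν` plus a term of order `h` (`areaVec_shift`). The
main part yields `J_q` times the off-surface expression whose limit is `Ng`. The remainder yields
`deviation`: its factor `h` cancels one order of the singularity of `∇Φ`, because the distance to
`Γ` is at least `c |h|`. Hence `deviation` has a weakly singular kernel, is continuous up to `h =
0`, and vanishes there (`continuous_deviation`). Continuity of `g` is enough for this.

The potential itself is weakly singular, hence continuous across `Γ` (`continuous_pot_shift`). The
uniform existence of `Ng` allows the limit on the left. Finally `e^{it} = cos t + i sin t`
identifies `2 Ag ∘ q` with the parametrized single layer (`singleLayer_eq`), and `ψ` is taken to be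
the conjugate of `φ`.

For Hölder densities, Stokes' theorem with `ψ = 1` shows that the flux through `Γ` of the curl of
`Φ(z, ·) b` vanishes for `z ∉ Γ` and constant `b` (`integral_flux_kernel`). Subtracting this with `b
= g(x)` leaves a kernel of order `|x - y|^(α - 2)`, whose integral is continuous up to `Γ`.

Both arguments rest on `weaklySingular` (continuity of weakly singular integrals in a parameter) and
on `exists_dist_bound` (a quantitative tubular neighbourhood). Stokes' theorem is obtained from
integration by parts in `ℝ³`, by means of radially constant extensions and a radial cut-off. -/

namespace SphereBIE

/-! ### Smooth functions on the sphere through their radially constant extensions. -/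

section Ext

set_option linter.unusedSectionVars false

variable {F F' : Type*} [NormedAddCommGroup F] [NormedSpace ℝ F]
  [NormedAddCommGroup F'] [NormedSpace ℝ F']

/-- The radial projection of a nonzero vector to the unit sphere. -/
noncomputable def toS2 (x : E3) (h : x ≠ 0) : S2 :=
  ⟨‖x‖⁻¹ • x, by simp [norm_smul, inv_mul_cancel₀ (norm_ne_zero_iff.mpr h)]⟩

theorem S2.coe_ne_zero (x : S2) : (x : E3) ≠ 0 := by
  have := x.2
  intro h
  simp [h] at this

@[simp] theorem S2.norm_coe (x : S2) : ‖(x : E3)‖ = 1 := by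
  simp

theorem radialExt_of_ne (f : S2 → F) {x : E3} (h : x ≠ 0) : radialExt f x = f (toS2 x h) := by
  simp [radialExt, h, toS2]

@[simp] theorem radialExt_coe (f : S2 → F) (x : S2) : radialExt f (x : E3) = f x := by
  rw [radialExt_of_ne f (S2.coe_ne_zero x)]
  congr 1
  ext
  simp [toS2]

theorem radialExt_smul_vec (f : S2 → F) {r : ℝ} (hr : 0 < r) (x : E3) :
    radialExt f (r • x) = radialExt f x := by
  by_cases h : x = 0
  · simp [h]
  · rw [radialExt_of_ne f h, radialExt_of_ne f (smul_ne_zero hr.ne' h)]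
    congr 1
    ext1
    simp only [toS2, norm_smul, Real.norm_of_nonneg hr.le, smul_smul]
    congr 1
    field_simp

/-- The radially constant extension of `f` is smooth away from the origin. -/
def SmoothExt (f : S2 → F) : Prop := ∀ x : E3, x ≠ 0 → ContDiffAt ℝ ∞ (radialExt f) x

/-- The extension is `f` composed with the radial projection, which is a smooth map from the open
submanifold `ℝ³ ∖ {0}` to the sphere. From here on, manifold calculus is replaced by calculus in `ℝ³
∖ {0}`. -/
theorem IsSmooth.smoothExt {f : S2 → F} (hf : IsSmooth f) : SmoothExt f := by
  intro x hx
  let U : TopologicalSpace.Opens E3 := ⟨{0}ᶜ, isOpen_compl_singleton⟩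
  have hU : ∀ y : U, (y : E3) ≠ 0 := fun y => y.2
  have h1 : ContMDiff 𝓘(ℝ, E3) 𝓘(ℝ, E3) ∞ (fun y : U => ‖(y : E3)‖⁻¹ • (y : E3)) := by
    intro y
    have : ContDiffAt ℝ ∞ (fun z : E3 => ‖z‖⁻¹ • z) (y : E3) :=
      ((contDiffAt_norm ℝ (hU y)).inv (norm_ne_zero_iff.mpr (hU y))).smul contDiffAt_id
    exact (contMDiffAt_subtype_iff (U := U) (f := fun z : E3 => ‖z‖⁻¹ • z)).mpr this.contMDiffAt
  have : Fact (Module.finrank ℝ E3 = 2 + 1) := ⟨by simp⟩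
  have h2 : ContMDiff 𝓘(ℝ, E3) (𝓡 2) ∞ (fun y : U => toS2 y (hU y)) :=
    h1.codRestrict_sphere (n := 2) _
  have h3 := hf.comp h2
  have h4 : ContMDiff 𝓘(ℝ, E3) 𝓘(ℝ, F) ∞ (fun y : U => radialExt f (y : E3)) := by
    refine h3.congr fun y => ?_
    rw [radialExt_of_ne f (hU y)]
    rfl
  exact ((contMDiffAt_subtype_iff (U := U) (f := radialExt f)).mp (h4 ⟨x, hx⟩)).contDiffAt

theorem SmoothExt.continuous {f : S2 → F} (hf : SmoothExt f) : Continuous f := by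
  have : f = fun x : S2 => radialExt f (x : E3) := by ext x; simp
  rw [this, continuous_iff_continuousAt]
  intro x
  exact (hf x (S2.coe_ne_zero x)).continuousAt.comp continuous_subtype_val.continuousAt

/-- A function that is smooth near the sphere restricts to a function with smooth extension. -/
theorem smoothExt_restrict {g : E3 → F} (hg : ∀ x : S2, ContDiffAt ℝ ∞ g (x : E3)) :
    SmoothExt (fun x : S2 => g x) := by
  intro x hx
  have h1 : ContDiffAt ℝ ∞ (fun z : E3 => ‖z‖⁻¹ • z) x :=
    ((contDiffAt_norm ℝ hx).inv (norm_ne_zero_iff.mpr hx)).smul contDiffAt_id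
  have h2 : ContDiffAt ℝ ∞ (fun z : E3 => g (‖z‖⁻¹ • z)) x :=
    ContDiffAt.comp x (g := g) (hg (toS2 x hx)) h1
  refine h2.congr_of_eventuallyEq ?_
  filter_upwards [isOpen_compl_singleton.mem_nhds hx] with z hz
  rw [radialExt_of_ne _ hz]
  rfl

theorem SmoothExt.add {f g : S2 → F} (hf : SmoothExt f) (hg : SmoothExt g) :
    SmoothExt (fun x => f x + g x) := by
  simpa using smoothExt_restrict (g := fun x => radialExt f x + radialExt g x) fun x =>
    (hf x (S2.coe_ne_zero x)).add (hg x (S2.coe_ne_zero x))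

theorem SmoothExt.const_smul {f : S2 → F} (hf : SmoothExt f) (c : ℝ) :
    SmoothExt (fun x => c • f x) := by
  simpa using smoothExt_restrict (g := fun x => c • radialExt f x) fun x =>
    (hf x (S2.coe_ne_zero x)).const_smul c

theorem SmoothExt.clm_comp {f : S2 → F} (hf : SmoothExt f) (L : F →L[ℝ] F') :
    SmoothExt (fun x => L (f x)) := by
  simpa using smoothExt_restrict (g := fun x => L (radialExt f x)) fun x =>
    L.contDiff.contDiffAt.comp (x : E3) (hf x (S2.coe_ne_zero x))

theorem smoothExt_const (c : F) : SmoothExt (fun _ : S2 => c) :=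
  smoothExt_restrict (g := fun _ => c) fun _ => contDiffAt_const

/-- A radial cut-off function: equal to `1` on the sphere, vanishing near `0`, compactly
supported. -/
noncomputable def cut : ContDiffBump (1 : ℝ) :=
  { rIn := 1 / 4, rOut := 1 / 2, rIn_pos := by norm_num, rIn_lt_rOut := by norm_num }

theorem cut_eq_zero {x : E3} (hx : ‖x‖ ^ 2 ∉ Metric.ball (1 : ℝ) (1 / 2)) :
    cut (‖x‖ ^ 2) = 0 := by
  have : Function.support cut = Metric.ball (1 : ℝ) (1 / 2) := cut.support_eq
  rw [← this] at hx
  simpa using hx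

theorem cut_coe (x : S2) : cut (‖(x : E3)‖ ^ 2) = 1 := by
  rw [S2.norm_coe, one_pow]
  exact cut.one_of_mem_closedBall (by simp [cut])

theorem cut_eventually_zero : ∀ᶠ x in 𝓝 (0 : E3), cut (‖x‖ ^ 2) = 0 := by
  have : ∀ᶠ x in 𝓝 (0 : E3), ‖x‖ ^ 2 < 1 / 2 := by
    have hc : Continuous fun x : E3 => ‖x‖ ^ 2 := by fun_prop
    exact hc.continuousAt.eventually_lt continuousAt_const (by simp)
  filter_upwards [this] with x hx
  apply cut_eq_zero
  rw [Metric.mem_ball, Real.dist_eq, abs_lt]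
  rintro ⟨h1, _⟩
  linarith

theorem contDiff_cut : ContDiff ℝ ∞ fun x : E3 => cut (‖x‖ ^ 2) :=
  cut.contDiff.comp (contDiff_norm_sq ℝ)

theorem hasCompactSupport_cut : HasCompactSupport fun x : E3 => cut (‖x‖ ^ 2) := by
  refine HasCompactSupport.intro (isCompact_closedBall (0 : E3) 2) fun x hx => ?_
  apply cut_eq_zero
  rw [mem_closedBall_zero_iff, not_le] at hx
  rw [Metric.mem_ball, Real.dist_eq, abs_lt]
  rintro ⟨_, h1⟩
  nlinarith

/-- The cut-off vanishes identically near `0`, so whatever `f` does at the origin is harmless. -/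
theorem contDiff_cut_smul {n : ℕ∞ω} (hn : n ≤ ∞) {f : E3 → F}
    (hf : ∀ x : E3, x ≠ 0 → ContDiffAt ℝ n f x) :
    ContDiff ℝ n fun x : E3 => cut (‖x‖ ^ 2) • f x := by
  rw [contDiff_iff_contDiffAt]
  intro x
  by_cases hx : x = 0
  · subst hx
    refine (contDiffAt_const (c := (0 : F))).congr_of_eventuallyEq ?_
    filter_upwards [cut_eventually_zero] with x hx
    simp [hx]
  · exact ((contDiff_cut.of_le hn).contDiffAt).smul (hf x hx)

/-- The extension times the cut-off is smooth and compactly supported on `ℝ³`, hence globally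
Lipschitz, and it equals `f` on the sphere. -/
theorem SmoothExt.exists_lipschitz [FiniteDimensional ℝ F] {f : S2 → F} (hf : SmoothExt f) :
    ∃ C : ℝ, 0 ≤ C ∧ ∀ x y : S2, ‖f x - f y‖ ≤ C * ‖(x : E3) - y‖ := by
  have h1 := contDiff_cut_smul le_rfl hf
  have h2 : HasCompactSupport fun x : E3 => cut (‖x‖ ^ 2) • radialExt f x :=
    hasCompactSupport_cut.smul_right
  obtain ⟨C, hC⟩ := ContDiff.lipschitzWith_of_hasCompactSupport h2 h1 (by simp)
  refine ⟨C, C.2, fun x y => ?_⟩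
  have := hC.dist_le_mul (x : E3) y
  rwa [dist_eq_norm, dist_eq_norm, cut_coe, cut_coe, radialExt_coe, radialExt_coe, one_smul,
    one_smul] at this

end Ext

end SphereBIE

/-! ### Geometry of the surface: tubular neighbourhood and distance estimates. -/

/-- A map with injective strict derivative on a compact set, injective on this set, expands
distances by a positive factor near the set. -/
theorem IsCompact.exists_antilipschitz_nhdsSet {E F : Type*} [NormedAddCommGroup E]
    [NormedSpace ℝ E] [FiniteDimensional ℝ E] [NormedAddCommGroup F] [NormedSpace ℝ F]
    {K : Set E} (hK : IsCompact K) {f : E → F} (hf : InjOn f K)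
    (hd : ∀ x ∈ K, ∃ f' : E →L[ℝ] F, HasStrictFDerivAt f f' x ∧ Function.Injective f') :
    ∃ c : ℝ, 0 < c ∧ ∀ᶠ z : E × E in 𝓝ˢ (K ×ˢ K), c * ‖z.1 - z.2‖ ≤ ‖f z.1 - f z.2‖ := by
  refine (hK.prod hK).induction_on (p := fun S => ∃ c : ℝ, 0 < c ∧ ∀ᶠ z : E × E in 𝓝ˢ S,
    c * ‖z.1 - z.2‖ ≤ ‖f z.1 - f z.2‖) ⟨1, one_pos, by simp⟩ ?_ ?_ ?_
  · rintro s t hst ⟨c, hc, h⟩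
    exact ⟨c, hc, h.filter_mono (nhdsSet_mono hst)⟩
  · rintro s t ⟨c, hc, h⟩ ⟨d, hd, h'⟩
    refine ⟨min c d, lt_min hc hd, ?_⟩
    rw [nhdsSet_union, eventually_sup]
    constructor
    · filter_upwards [h] with z hz
      exact (mul_le_mul_of_nonneg_right (min_le_left _ _) (norm_nonneg _)).trans hz
    · filter_upwards [h'] with z hz
      exact (mul_le_mul_of_nonneg_right (min_le_right _ _) (norm_nonneg _)).trans hz
  · rintro ⟨a, b⟩ ⟨ha, hb⟩
    suffices h : ∃ c : ℝ, 0 < c ∧ ∀ᶠ z : E × E in 𝓝 (a, b),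
        c * ‖z.1 - z.2‖ ≤ ‖f z.1 - f z.2‖ by
      obtain ⟨c, hc, h⟩ := h
      refine ⟨_, mem_nhdsWithin_of_mem_nhds h.eventually_nhds, c, hc, ?_⟩
      exact eventually_nhdsSet_iff_forall.mpr fun x hx => hx
    obtain ⟨fa, hfa, hia⟩ := hd a ha
    obtain ⟨fb, hfb, -⟩ := hd b hb
    dsimp only at ha hb
    -- The property is local on `K × K`. Near a diagonal point the injective strict derivative gives
    -- the expansion; near an off-diagonal point injectivity keeps the images apart and continuity
    -- suffices.
    by_cases hab : a = b
    · subst hab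
      obtain ⟨k, hk, hak⟩ := fa.toLinearMap.exists_antilipschitzWith (LinearMap.ker_eq_bot.mpr hia)
      have hk' : (0 : ℝ) < k := hk
      refine ⟨1 / (2 * k), by positivity, ?_⟩
      have := hfa.isLittleO.def (c := 1 / (2 * k)) (by positivity)
      filter_upwards [this] with z hz
      have h1 : ‖z.1 - z.2‖ ≤ k * ‖fa (z.1 - z.2)‖ := by
        simpa [dist_eq_norm] using hak.le_mul_dist (z.1 - z.2) 0
      have h2 : ‖fa (z.1 - z.2)‖ ≤ ‖f z.1 - f z.2‖ + ‖f z.1 - f z.2 - fa (z.1 - z.2)‖ := by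
        have := norm_sub_norm_le (fa (z.1 - z.2)) (f z.1 - f z.2)
        rw [norm_sub_rev (fa _)] at this
        linarith
      have h3 : 1 / k * ‖z.1 - z.2‖ ≤ ‖fa (z.1 - z.2)‖ := by
        rw [one_div, inv_mul_le_iff₀ hk']
        exact h1
      have h4 : 1 / (k : ℝ) = 1 / (2 * k) + 1 / (2 * k) := by field_simp; norm_num
      rw [h4, add_mul] at h3
      linarith
    · have hne : 0 < ‖f a - f b‖ := by
        rw [norm_pos_iff, sub_ne_zero]
        exact fun h => hab (hf ha hb h)
      have hne' : 0 < ‖a - b‖ := by rwa [norm_pos_iff, sub_ne_zero]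
      refine ⟨‖f a - f b‖ / (2 * ‖a - b‖), by positivity, ?_⟩
      have hca : ContinuousAt (fun z : E × E => f z.1) (a, b) :=
        ContinuousAt.comp (x := (a, b)) (f := Prod.fst) hfa.continuousAt continuousAt_fst
      have hcb : ContinuousAt (fun z : E × E => f z.2) (a, b) :=
        ContinuousAt.comp (x := (a, b)) (f := Prod.snd) hfb.continuousAt continuousAt_snd
      have h1 : ContinuousAt (fun z : E × E => ‖f z.1 - f z.2‖) (a, b) := (hca.sub hcb).norm
      have h2 : ContinuousAt
          (fun z : E × E => ‖f a - f b‖ / (2 * ‖a - b‖) * ‖z.1 - z.2‖) (a, b) := by fun_prop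
      refine (h2.eventually_lt h1 ?_).mono fun z hz => hz.le
      have : ‖f a - f b‖ / (2 * ‖a - b‖) * ‖a - b‖ = ‖f a - f b‖ / 2 := by field_simp
      simp only [this]
      linarith

namespace SphereBIE

/-- The unit normal `ν ∘ q` as a function on the sphere. -/
noncomputable def nuS (q : S2 → E3) (x : S2) : E3 := (jac q x)⁻¹ • areaVec q x

variable {q : S2 → E3}

theorem IsParametrization.normal_apply (hq : IsParametrization q) (x : S2) :
    normal q (q x) = nuS q x := by
  rw [normal, hq.injective.extend_apply, nuS]

theorem IsParametrization.jac_pos (hq : IsParametrization q) (x : S2) : 0 < jac q x :=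
  lt_of_le_of_ne (norm_nonneg _) (hq.jac_ne_zero x).symm

theorem IsParametrization.areaVec_eq (hq : IsParametrization q) (x : S2) :
    areaVec q x = jac q x • nuS q x := by
  rw [nuS, smul_smul, mul_inv_cancel₀ (hq.jac_ne_zero x), one_smul]

theorem IsParametrization.norm_nuS (hq : IsParametrization q) (x : S2) : ‖nuS q x‖ = 1 := by
  rw [nuS, norm_smul, norm_inv, Real.norm_of_nonneg (hq.jac_pos x).le]
  exact inv_mul_cancel₀ (hq.jac_ne_zero x)

/-- The entries of the Jacobian matrix of the radial extension. -/
noncomputable def jacEntry (p : S2 → E3) (i j : Fin 3) (x : E3) : ℝ :=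
  fderiv ℝ (radialExt p) x (EuclideanSpace.single j 1) i

theorem DS2_apply (p : S2 → E3) (x : S2) (i j : Fin 3) : DS2 p x i j = jacEntry p i j x := rfl

theorem SmoothExt.jacEntry {p : S2 → E3} (hp : SmoothExt p) (i j : Fin 3) {x : E3} (hx : x ≠ 0) :
    ContDiffAt ℝ ∞ (SphereBIE.jacEntry p i j) x := by
  have h1 : ContDiffAt ℝ ∞ (fun y => fderiv ℝ (radialExt p) y (EuclideanSpace.single j 1)) x :=
    ((hp x hx).fderiv_right (m := ∞) (by simp)).clm_apply contDiffAt_const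
  exact (contDiffAt_euclidean.mp h1) i

theorem SmoothExt.areaVec {p : S2 → E3} (hp : SmoothExt p) : SmoothExt (areaVec p) := by
  -- This function of `w` is not the radial extension of the area vector. It only agrees with the
  -- area vector on the sphere, which is all `smoothExt_restrict` needs.
  have key : ∀ x : S2, ContDiffAt ℝ ∞ (fun w : E3 => (WithLp.toLp 2
      ((Matrix.of fun i j => SphereBIE.jacEntry p i j w).adjugateᵀ *ᵥ w.ofLp) : E3)) (x : E3) := by
    intro x
    have he := fun i j => hp.jacEntry i j (S2.coe_ne_zero x)
    have hc : ∀ i, ContDiffAt ℝ ∞ (fun w : E3 => w i) (x : E3) := fun i =>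
      contDiffAt_euclidean.mp contDiffAt_id i
    rw [contDiffAt_euclidean]
    intro i
    have hpoly : ∀ a b c d : Fin 3, ContDiffAt ℝ ∞ (fun w => SphereBIE.jacEntry p a b w *
        SphereBIE.jacEntry p c d w) (x : E3) := fun a b c d => (he a b).mul (he c d)
    fin_cases i <;>
    · simp only [Matrix.mulVec, dotProduct, Fin.sum_univ_three, Matrix.adjugate_fin_three,
        Matrix.transpose_apply, Matrix.of_apply, Matrix.cons_val', Matrix.cons_val_zero,
        Matrix.cons_val_one, Matrix.cons_val, Fin.zero_eta, Fin.mk_one, Fin.reduceFinMk,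
        Fin.isValue]
      fun_prop (disch := assumption)
  exact smoothExt_restrict key

theorem IsParametrization.smoothExt (hq : IsParametrization q) : SmoothExt q :=
  hq.smooth.smoothExt

theorem IsParametrization.smoothExt_jac (hq : IsParametrization q) : SmoothExt (jac q) := by
  have := smoothExt_restrict (g := fun x => ‖radialExt (areaVec q) x‖) fun x =>
    (hq.smoothExt.areaVec x (S2.coe_ne_zero x)).norm ℝ (by
      rw [radialExt_coe, ← norm_ne_zero_iff]; exact hq.jac_ne_zero x)
  simp only [radialExt_coe] at this
  exact this

theorem IsParametrization.smoothExt_nuS (hq : IsParametrization q) : SmoothExt (nuS q) := by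
  have := smoothExt_restrict (g := fun x => (radialExt (jac q) x)⁻¹ • radialExt (areaVec q) x)
    fun x => ((hq.smoothExt_jac x (S2.coe_ne_zero x)).inv (by
      rw [radialExt_coe]; exact hq.jac_ne_zero x)).smul (hq.smoothExt.areaVec x (S2.coe_ne_zero x))
  simp only [radialExt_coe] at this
  exact this

theorem SmoothExt.fderiv_self {F : Type*} [NormedAddCommGroup F] [NormedSpace ℝ F]
    {f : S2 → F} (hf : SmoothExt f) {x : E3} (hx : x ≠ 0) : fderiv ℝ (radialExt f) x x = 0 := by
  have h1 : HasFDerivAt (radialExt f) (fderiv ℝ (radialExt f) x) ((1 : ℝ) • x) := by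
    rw [one_smul]
    exact ((hf x hx).differentiableAt (by simp)).hasFDerivAt
  have h2 : HasDerivAt (fun r : ℝ => r • x) x 1 := by
    simpa using (hasDerivAt_id (1 : ℝ)).smul_const x
  have h3 := h1.comp_hasDerivAt (1 : ℝ) h2
  have h4 : HasDerivAt (radialExt f ∘ fun r : ℝ => r • x) 0 1 := by
    refine (hasDerivAt_const (1 : ℝ) (radialExt f x)).congr_of_eventuallyEq ?_
    filter_upwards [eventually_gt_nhds (zero_lt_one (α := ℝ))] with r hr
    exact radialExt_smul_vec f hr x
  exact h3.unique h4

theorem DS2_mulVec (p : S2 → E3) (x : S2) (v : E3) :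
    DS2 p x *ᵥ v.ofLp = (fderiv ℝ (radialExt p) (x : E3) v).ofLp := by
  have hv : v = ∑ j, v j • EuclideanSpace.single j (1 : ℝ) := by
    ext i
    simp [Finset.sum_apply, Pi.single_apply]
  conv_rhs => rw [hv]
  ext i
  simp [Matrix.mulVec, dotProduct, DS2, mul_comm]

/-- The matrix `D` kills `x̂`, so `det D = 0`, and the pairing is `x̂ · adj(D) D v = det D (x̂ ·
v)`. -/
theorem areaVec_dot_DS2 (p : S2 → E3) (hp : SmoothExt p) (x : S2) (v : Fin 3 → ℝ) :
    (areaVec p x).ofLp ⬝ᵥ (DS2 p x *ᵥ v) = 0 := by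
  have h0 : DS2 p x *ᵥ (x : E3).ofLp = 0 := by
    rw [DS2_mulVec, hp.fderiv_self (S2.coe_ne_zero x)]
    rfl
  have hdet : (DS2 p x).det = 0 := by
    rw [← Matrix.exists_mulVec_eq_zero_iff]
    refine ⟨_, fun h => S2.coe_ne_zero x ?_, h0⟩
    ext i
    exact congrFun h i
  rw [areaVec, Matrix.mulVec_transpose, ← Matrix.dotProduct_mulVec, Matrix.mulVec_mulVec,
    Matrix.adjugate_mul, hdet]
  simp

/-- A nonzero tangent vector `v` has the companion `b = (x̂ × v) / |v|²` with `v × b = x̂`. The area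
vector is then `D v × D b`, which would vanish with `D v`. -/
theorem IsParametrization.eq_zero_of_DS2 (hq : IsParametrization q) (x : S2) (v : Fin 3 → ℝ)
    (hv : (x : E3).ofLp ⬝ᵥ v = 0) (h : DS2 q x *ᵥ v = 0) : v = 0 := by
  by_contra hne
  have hn : v ⬝ᵥ v ≠ 0 := by simpa using hne
  have hx := areaVec_eq_cross q x v ((v ⬝ᵥ v)⁻¹ • ((x : E3).ofLp ⨯₃ v)) (by
    rw [map_smul]
    have : v ⨯₃ ((x : E3).ofLp ⨯₃ v) = (v ⬝ᵥ v) • (x : E3).ofLp := by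
      generalize (x : E3).ofLp = y at hv
      simp only [dotProduct, Fin.sum_univ_three] at hv
      ext i
      fin_cases i <;> simp [cross_apply, dotProduct, Fin.sum_univ_three]
      · linear_combination (-v 0) * hv
      · linear_combination (-v 1) * hv
      · linear_combination (-v 2) * hv
    rw [this, smul_smul, inv_mul_cancel₀ hn, one_smul])
  rw [h] at hx
  apply hq.jac_ne_zero x
  rw [jac, norm_eq_zero]
  ext i
  rw [hx]
  simp

/-- The map `(1 + h) x̂ ↦ q(x̂) + h ν(q(x̂))`. -/
noncomputable def tube (q : S2 → E3) (w : E3) : E3 :=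
  radialExt q w + (‖w‖ - 1) • radialExt (nuS q) w

theorem tube_smul (q : S2 → E3) (x : S2) {h : ℝ} (hh : -1 < h) :
    tube q ((1 + h) • (x : E3)) = q x + h • nuS q x := by
  have h1 : 0 < 1 + h := by linarith
  rw [tube, radialExt_smul_vec _ h1, radialExt_smul_vec _ h1, radialExt_coe, radialExt_coe,
    norm_smul, S2.norm_coe, Real.norm_of_nonneg h1.le]
  congr 2
  ring

theorem tube_coe (q : S2 → E3) (x : S2) : tube q (x : E3) = q x := by
  simpa using tube_smul q x (h := 0) (by norm_num)

/-- On the sphere the factor `‖w‖ - 1` vanishes, so the derivative is `v ↦ Dq v + ⟨x̂, v⟩ ν`.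
Pairing a kernel vector with the area vector removes the first term and shows that it is tangent;
`eq_zero_of_DS2` then applies. -/
theorem IsParametrization.tube_deriv (hq : IsParametrization q) (x : S2) :
    ∃ f' : E3 →L[ℝ] E3, HasStrictFDerivAt (tube q) f' (x : E3) ∧ Function.Injective f' := by
  have hx := S2.coe_ne_zero x
  have h1 := (hq.smoothExt x hx).hasStrictFDerivAt (by simp)
  have h2 := (hq.smoothExt_nuS x hx).hasStrictFDerivAt (by simp)
  have h3 : HasStrictFDerivAt (fun w : E3 => ‖w‖) (innerSL ℝ (x : E3)) (x : E3) := by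
    have h4 := (contDiffAt_norm (n := 1) ℝ hx).hasStrictFDerivAt (by simp)
    suffices h : innerSL ℝ (x : E3) = fderiv ℝ norm (x : E3) by rw [h]; exact h4
    ext v
    have h5 := (hasStrictFDerivAt_norm_sq (x : E3)).hasFDerivAt.unique (h4.pow 2).hasFDerivAt
    have := congrArg (fun L : E3 →L[ℝ] ℝ => L v) h5
    simp at this
    exact this
  have h4 := h1.add ((h3.sub_const 1).smul h2)
  refine ⟨_, h4, ?_⟩
  rw [injective_iff_map_eq_zero]
  intro v hv
  simp only [S2.norm_coe, sub_self, radialExt_coe] at hv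
  have hv' : fderiv ℝ (radialExt q) (x : E3) v + inner ℝ (x : E3) v • nuS q x = 0 := by
    simpa using hv
  have hd := areaVec_dot_DS2 q hq.smoothExt x v.ofLp
  rw [DS2_mulVec] at hd
  have hin : inner ℝ (areaVec q x) (fderiv ℝ (radialExt q) (x : E3) v) = 0 := by
    rw [EuclideanSpace.inner_eq_star_dotProduct, dotProduct_comm]
    simpa using hd
  have h6 : inner ℝ (x : E3) v = 0 := by
    have h7 := congrArg (fun u => inner ℝ (areaVec q x) u) hv'
    simp only [inner_add_right, hin, inner_smul_right, inner_zero_right, zero_add] at h7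
    rcases mul_eq_zero.mp h7 with h8 | h8
    · exact h8
    · exfalso
      rw [nuS, inner_smul_right, real_inner_self_eq_norm_sq] at h8
      have := hq.jac_pos x
      have h9 : 0 < ‖areaVec q x‖ := this
      have : 0 < (jac q x)⁻¹ * ‖areaVec q x‖ ^ 2 := by positivity
      exact this.ne' h8
  rw [h6, zero_smul, add_zero] at hv'
  have h10 := hq.eq_zero_of_DS2 x v.ofLp (by
    rw [EuclideanSpace.inner_eq_star_dotProduct, dotProduct_comm] at h6
    simpa using h6) (by rw [DS2_mulVec, hv']; rfl)
  ext i
  exact congrFun h10 i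

/-- Distances between points of the surface and points of nearby parallel surfaces. -/
theorem IsParametrization.exists_dist_bound (hq : IsParametrization q) :
    ∃ c δ : ℝ, 0 < c ∧ 0 < δ ∧ ∀ (h : ℝ) (x y : S2), |h| ≤ δ →
      c * ‖(x : E3) - y‖ ≤ ‖q x + h • nuS q x - q y‖ ∧
      c * |h| ≤ ‖q x + h • nuS q x - q y‖ := by
  have hinj : InjOn (tube q) (Metric.sphere (0 : E3) 1) := by
    intro x hx y hy hxy
    have := hq.injective (a₁ := ⟨x, hx⟩) (a₂ := ⟨y, hy⟩) (by
      simpa only [← tube_coe] using hxy)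
    exact congrArg Subtype.val this
  obtain ⟨c, hc, h⟩ := (isCompact_sphere (0 : E3) 1).exists_antilipschitz_nhdsSet hinj
    fun x hx => hq.tube_deriv ⟨x, hx⟩
  obtain ⟨δ, hδ, h⟩ := (Metric.hasBasis_nhdsSet_cthickening
    ((isCompact_sphere (0 : E3) 1).prod (isCompact_sphere (0 : E3) 1))).eventually_iff.mp h
  -- The tube map expands distances by `c`, and `|x̂ - ŷ| ≤ |(1 + t) x̂ - ŷ| + |t| ≤ 2 |(1 + t) x̂ -
  -- ŷ|`, which costs the factor `2`. The bound `1 / 2` keeps `1 + t` positive.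
  refine ⟨c / 2, min δ (1 / 2), by positivity, by positivity, fun t x y ht => ?_⟩
  have ht1 : |t| ≤ δ := ht.trans (min_le_left _ _)
  have ht2 := abs_le.mp (ht.trans (min_le_right _ _))
  have hmem : (((1 + t) • (x : E3), (y : E3)) : E3 × E3) ∈ Metric.cthickening δ
      (Metric.sphere (0 : E3) 1 ×ˢ Metric.sphere (0 : E3) 1) := by
    refine Metric.mem_cthickening_of_dist_le _ ((x : E3), (y : E3)) _ _ ⟨x.2, y.2⟩ ?_
    rw [Prod.dist_eq, dist_self, dist_eq_norm, add_smul, one_smul, add_sub_cancel_left, norm_smul,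
      S2.norm_coe, mul_one, Real.norm_eq_abs]
    exact max_le ht1 hδ.le
  have key := h hmem
  simp only [tube_coe, tube_smul q x (show -1 < t by linarith)] at key
  have h1 : |t| ≤ ‖(1 + t) • (x : E3) - y‖ := by
    have := abs_norm_sub_norm_le ((1 + t) • (x : E3)) y
    rwa [norm_smul, S2.norm_coe, S2.norm_coe, Real.norm_of_nonneg (by linarith), mul_one,
      add_sub_cancel_left] at this
  have h2 : ‖(x : E3) - y‖ ≤ ‖(1 + t) • (x : E3) - y‖ + |t| := by
    have : (x : E3) - y = ((1 + t) • (x : E3) - y) - t • (x : E3) := by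
      rw [add_smul, one_smul]; abel
    rw [this]
    refine (norm_sub_le _ _).trans ?_
    rw [norm_smul, S2.norm_coe, mul_one, Real.norm_eq_abs]
  constructor
  · nlinarith
  · nlinarith [abs_nonneg t]

end SphereBIE

/-! ### Weakly singular integrals on the sphere. -/

namespace SphereBIE

instance : IsFiniteMeasure dsS2 := inferInstanceAs (IsFiniteMeasure (Measure.toSphere _))

open scoped Pointwise in
/-- The area of a spherical cap is at most quadratic in its radius. -/
theorem exists_cap_bound : ∃ C : ℝ, 0 ≤ C ∧ ∀ (x : S2) (r : ℝ), 0 < r → r ≤ 4 →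
    dsS2 {y : S2 | ‖(x : E3) - y‖ ≤ r} ≤ ENNReal.ofReal (C * r ^ 2) := by
  set V : ℝ := (volume : Measure E3).real (Metric.ball 0 1) with hV
  refine ⟨3 * (243 * V), by positivity, fun x r hr hr4 => ?_⟩
  have hm : MeasurableSet {y : S2 | ‖(x : E3) - y‖ ≤ r} :=
    (isClosed_le (by fun_prop) continuous_const).measurableSet
  set n : ℕ := ⌈1 / r⌉₊ with hn
  have hn0 : 0 < n := Nat.ceil_pos.mpr (by positivity)
  have hn1 : 1 / r ≤ n := Nat.le_ceil _
  have hn2 : (n : ℝ) < 1 / r + 1 := Nat.ceil_lt_add_one (by positivity)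
  have hn0' : (0 : ℝ) < n := by exact_mod_cast hn0
  -- `toSphere` measures a cap by three times the volume of the cone over it. The cone is covered by
  -- about `1 / r` balls of radius `3 r` centred on the segment from `0` to `x̂`, of total volume of
  -- order `r²`.
  have hsub : Ioo (0 : ℝ) 1 • ((↑) '' {y : S2 | ‖(x : E3) - y‖ ≤ r} : Set E3) ⊆
      ⋃ k ∈ Finset.range (n + 1), Metric.ball (((k : ℝ) / n) • (x : E3)) (3 * r) := by
    rintro _ ⟨t, ⟨ht0, ht1⟩, _, ⟨y, hy, rfl⟩, rfl⟩
    simp only [mem_iUnion, Metric.mem_ball, dist_eq_norm]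
    have hk : (⌊t * n⌋₊ : ℝ) ≤ t * n := Nat.floor_le (by positivity)
    have hk2 : t * n < ⌊t * n⌋₊ + 1 := Nat.lt_floor_add_one _
    refine ⟨⌊t * n⌋₊, ?_, ?_⟩
    · rw [Finset.mem_range, Nat.lt_succ_iff]
      have : (⌊t * n⌋₊ : ℝ) ≤ n := hk.trans (by nlinarith)
      exact_mod_cast this
    · have h1 : t • (y : E3) - ((⌊t * n⌋₊ : ℝ) / n) • (x : E3) =
          (t - (⌊t * n⌋₊ : ℝ) / n) • (x : E3) - t • ((x : E3) - y) := by
        rw [sub_smul, smul_sub]; abel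
      have h2 : |t - (⌊t * n⌋₊ : ℝ) / n| ≤ r := by
        have h3 : t - (⌊t * n⌋₊ : ℝ) / n = (t * n - ⌊t * n⌋₊) / n := by field_simp
        rw [h3, abs_of_nonneg (div_nonneg (by linarith) hn0'.le), div_le_iff₀ hn0']
        rw [div_le_iff₀ hr] at hn1
        nlinarith
      change ‖t • (y : E3) - ((⌊t * n⌋₊ : ℝ) / n) • (x : E3)‖ < 3 * r
      rw [h1]
      refine (norm_sub_le _ _).trans_lt ?_
      rw [norm_smul, norm_smul, S2.norm_coe, Real.norm_eq_abs, Real.norm_of_nonneg ht0.le]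
      have hy' : ‖(x : E3) - y‖ ≤ r := hy
      nlinarith [norm_nonneg ((x : E3) - y)]
  rw [dsS2, Measure.toSphere_apply' _ hm]
  have hball : ∀ k : ℕ, (volume : Measure E3) (Metric.ball (((k : ℝ) / n) • (x : E3)) (3 * r)) =
      ENNReal.ofReal ((3 * r) ^ 3 * V) := by
    intro k
    rw [Measure.addHaar_ball _ _ (by positivity), finrank_euclideanSpace_fin,
      ENNReal.ofReal_mul (by positivity), hV, ofReal_measureReal]
  have hvol : (volume : Measure E3) (Ioo (0 : ℝ) 1 • ((↑) '' {y : S2 | ‖(x : E3) - y‖ ≤ r})) ≤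
      ENNReal.ofReal (243 * V * r ^ 2) := by
    refine (measure_mono hsub).trans ((measure_biUnion_finset_le _ _).trans ?_)
    rw [Finset.sum_congr rfl fun k _ => hball k, Finset.sum_const, Finset.card_range,
      ← ENNReal.ofReal_nsmul]
    refine ENNReal.ofReal_le_ofReal ?_
    rw [nsmul_eq_mul]
    push_cast
    have hV0 : 0 ≤ V := measureReal_nonneg
    -- Here `(n + 1) r ≤ 1 + 2 r ≤ 9`, and `27 · 9 = 243`.
    have h5 : ((n : ℝ) + 1) * (3 * r) ^ 3 ≤ 243 * r ^ 2 := by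
      have h6 : (n : ℝ) * r ≤ 1 + r := by
        have := mul_le_mul_of_nonneg_right hn2.le hr.le
        rwa [add_mul, one_div, inv_mul_cancel₀ hr.ne', one_mul] at this
      nlinarith [mul_le_mul_of_nonneg_right h6 (sq_nonneg r),
        mul_le_mul_of_nonneg_right hr4 (sq_nonneg r)]
    nlinarith [mul_le_mul_of_nonneg_right h5 hV0]
  refine (mul_le_mul_right hvol _).trans ?_
  rw [finrank_euclideanSpace_fin, ← nsmul_eq_mul, ← ENNReal.ofReal_nsmul]
  refine ENNReal.ofReal_le_ofReal ?_
  rw [nsmul_eq_mul]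
  push_cast
  linarith

theorem dsS2_singleton (x : S2) : dsS2 {x} = 0 := by
    obtain ⟨C, hC, h⟩ := exists_cap_bound
    have h1 : ∀ᶠ r : ℝ in 𝓝[>] 0, dsS2 {x} ≤ ENNReal.ofReal (C * r ^ 2) := by
      filter_upwards [Ioc_mem_nhdsGT (show (0 : ℝ) < 4 by norm_num)] with r hr
      refine (measure_mono ?_).trans (h x r hr.1 hr.2)
      rintro _ rfl
      simpa using hr.1.le
    have h2 : Tendsto (fun r : ℝ => ENNReal.ofReal (C * r ^ 2)) (𝓝[>] 0) (𝓝 0) := by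
      have : Continuous fun r : ℝ => ENNReal.ofReal (C * r ^ 2) :=
        ENNReal.continuous_ofReal.comp (by fun_prop)
      have h3 := this.tendsto 0
      simp only [ne_eq, OfNat.ofNat_ne_zero, not_false_eq_true, zero_pow, mul_zero,
        ENNReal.ofReal_zero] at h3
      exact h3.mono_left nhdsWithin_le_nhds
    exact le_antisymm (ge_of_tendsto h2 h1) (zero_le)

theorem ae_ne_dsS2 (x : S2) : ∀ᵐ y ∂dsS2, y ≠ x := by
  rw [ae_iff]
  simpa using dsS2_singleton x

/-- Dyadic shells: at distances between `δ / 2^(k+1)` and `δ / 2^k` the integrand is at most `b k`,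
and the area is of order `(δ / 2^k)²`. The resulting geometric series has ratio `2^(-(2 - p)) < 1`.
-/
theorem exists_cap_rpow_bound {p : ℝ} (hp : 0 < p) (hp2 : p < 2) :
    ∃ C : ℝ, 0 ≤ C ∧ ∀ (x : S2) (δ : ℝ), 0 < δ → δ ≤ 4 →
      ∫⁻ y in {y : S2 | ‖(x : E3) - y‖ ≤ δ}, ENNReal.ofReal (‖(x : E3) - y‖ ^ (-p)) ∂dsS2 ≤
        ENNReal.ofReal (C * δ ^ (2 - p)) := by
  obtain ⟨C, hC, hcap⟩ := exists_cap_bound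
  set ρ : ℝ := (1 / 2 : ℝ) ^ (2 - p) with hρ
  have hρ0 : 0 < ρ := by positivity
  have hρ1 : ρ < 1 := Real.rpow_lt_one (by norm_num) (by norm_num) (by linarith)
  refine ⟨C * 2 ^ p * (1 - ρ)⁻¹, ?_, fun x δ hδ hδ4 => ?_⟩
  · have : 0 < 1 - ρ := by linarith
    positivity
  set S : ℕ → Set S2 := fun k => {y : S2 | ‖(x : E3) - y‖ ≤ δ * (1 / 2) ^ k} with hS
  have hSm : ∀ k, MeasurableSet (S k) := fun k =>
    (isClosed_le (by fun_prop) continuous_const).measurableSet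
  have hdm : MeasurableSet {y : S2 | ‖(x : E3) - y‖ ≤ δ} :=
    (isClosed_le (by fun_prop) continuous_const).measurableSet
  set b : ℕ → ℝ := fun k => (δ * (1 / 2) ^ (k + 1)) ^ (-p) with hb
  have hpt : ∀ y ∈ {y : S2 | ‖(x : E3) - y‖ ≤ δ}, ENNReal.ofReal (‖(x : E3) - y‖ ^ (-p)) ≤
      ∑' k, (S k).indicator (fun _ => ENNReal.ofReal (b k)) y := by
    intro y hy
    have hy : ‖(x : E3) - y‖ ≤ δ := hy
    rcases (norm_nonneg ((x : E3) - y)).eq_or_lt with h0 | h0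
    -- At the centre the real power `0 ^ (-p)` has the default value `0`.
    · rw [← h0, Real.zero_rpow (by linarith)]
      simp
    · obtain ⟨k, hk1, hk2⟩ := exists_nat_pow_near_of_lt_one (x := ‖(x : E3) - y‖ / δ)
        (y := (1 / 2 : ℝ)) (by positivity) ((div_le_one hδ).mpr hy) (by norm_num) (by norm_num)
      rw [lt_div_iff₀' hδ] at hk1
      rw [div_le_iff₀' hδ] at hk2
      refine le_trans ?_ (ENNReal.le_tsum k)
      rw [indicator_of_mem (show y ∈ S k from hk2)]
      refine ENNReal.ofReal_le_ofReal ?_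
      exact Real.rpow_le_rpow_of_nonpos (by positivity) hk1.le (by linarith)
  calc ∫⁻ y in {y : S2 | ‖(x : E3) - y‖ ≤ δ}, ENNReal.ofReal (‖(x : E3) - y‖ ^ (-p)) ∂dsS2
      ≤ ∫⁻ y in {y : S2 | ‖(x : E3) - y‖ ≤ δ},
          ∑' k, (S k).indicator (fun _ => ENNReal.ofReal (b k)) y ∂dsS2 :=
        setLIntegral_mono' hdm hpt
    _ ≤ ∫⁻ y, ∑' k, (S k).indicator (fun _ => ENNReal.ofReal (b k)) y ∂dsS2 :=
        setLIntegral_le_lintegral _ _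
    _ = ∑' k, ∫⁻ y, (S k).indicator (fun _ => ENNReal.ofReal (b k)) y ∂dsS2 :=
        lintegral_tsum fun k => (measurable_const.indicator (hSm k)).aemeasurable
    _ = ∑' k, ENNReal.ofReal (b k) * dsS2 (S k) := by
        congr 1 with k
        rw [lintegral_indicator_const (hSm k)]
    _ ≤ ∑' k, ENNReal.ofReal (C * 2 ^ p * δ ^ (2 - p) * ρ ^ k) := by
        refine ENNReal.tsum_le_tsum fun k => ?_
        have h1 : δ * (1 / 2) ^ k ≤ 4 := by
          have : (1 / 2 : ℝ) ^ k ≤ 1 := pow_le_one₀ (by norm_num) (by norm_num)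
          nlinarith
        refine (mul_le_mul_right (hcap x _ (by positivity) h1) _).trans ?_
        rw [← ENNReal.ofReal_mul (by positivity)]
        refine ENNReal.ofReal_le_ofReal (le_of_eq ?_)
        have e1 : b k = δ ^ (-p) * 2 ^ p * ((1 / 2) ^ (-p)) ^ k := by
          simp only [hb]
          have e0 : (1 / 2 : ℝ) ^ (-p) = 2 ^ p := by
            rw [one_div, Real.inv_rpow (by norm_num), Real.rpow_neg (by norm_num), inv_inv]
          rw [Real.mul_rpow hδ.le (by positivity), ← Real.rpow_pow_comm (by norm_num), e0]
          ring
        have e2 : ρ = (1 / 2) ^ 2 * (1 / 2 : ℝ) ^ (-p) := by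
          rw [hρ, sub_eq_add_neg, Real.rpow_add (by norm_num)]
          norm_num
        have e3 : δ ^ (2 - p) = δ ^ 2 * δ ^ (-p) := by
          rw [sub_eq_add_neg, Real.rpow_add hδ]
          norm_num
        rw [e1, e2, e3, mul_pow, mul_pow, ← pow_mul, ← pow_mul, mul_comm 2 k]
        ring
    _ = ENNReal.ofReal (C * 2 ^ p * (1 - ρ)⁻¹ * δ ^ (2 - p)) := by
        rw [← ENNReal.ofReal_tsum_of_nonneg (fun k => by positivity)
          ((summable_geometric_of_lt_one hρ0.le hρ1).mul_left _), tsum_mul_left,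
          tsum_geometric_of_lt_one hρ0.le hρ1]
        congr 1
        ring

theorem tendsto_two_div : Tendsto (fun n : ℕ => 2 / ((n : ℝ) + 1)) atTop (𝓝 0) := by
  have := (tendsto_one_div_add_atTop_nhds_zero_nat (𝕜 := ℝ)).const_mul 2
  simpa [div_eq_mul_inv] using this

/-- A cut-off that vanishes near the diagonal of the sphere. -/
noncomputable def diagCut (n : ℕ) (r : ℝ) : ℝ := min 1 (max 0 ((n + 1) * r - 1))

theorem continuous_diagCut (n : ℕ) : Continuous (diagCut n) := by
  unfold diagCut; fun_prop

theorem diagCut_nonneg (n : ℕ) (r : ℝ) : 0 ≤ diagCut n r := by simp [diagCut]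

theorem diagCut_le_one (n : ℕ) (r : ℝ) : diagCut n r ≤ 1 := by simp [diagCut]

theorem diagCut_eq_zero {n : ℕ} {r : ℝ} (h : (n + 1) * r ≤ 1) : diagCut n r = 0 := by
  have : (n + 1) * r - 1 ≤ 0 := by linarith
  simp [diagCut, this]

theorem diagCut_eq_one {n : ℕ} {r : ℝ} (h : 2 / (n + 1) < r) : diagCut n r = 1 := by
  have hn : (0 : ℝ) < n + 1 := by positivity
  rw [div_lt_iff₀ hn] at h
  have : 1 ≤ (n + 1) * r - 1 := by linarith
  rw [diagCut, max_eq_right (by linarith), min_eq_left this]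

/-- A weakly singular integral on the sphere exists and depends continuously on a parameter. -/
theorem weaklySingular {T F : Type*} [TopologicalSpace T] [FirstCountableTopology T]
    [LocallyCompactSpace T] [NormedAddCommGroup F] [NormedSpace ℝ F] [CompleteSpace F]
    [SecondCountableTopology T]
    {π : T → S2} (hπ : Continuous π) {K : T → S2 → F}
    (hK : ∀ t y, π t ≠ y → ContinuousAt (Function.uncurry K) (t, y)) {p : ℝ} (hp : 0 < p)
    (hp2 : p < 2) {C : ℝ} (hC : 0 ≤ C)
    (hb : ∀ t y, π t ≠ y → ‖K t y‖ ≤ C * ‖(π t : E3) - y‖ ^ (-p)) :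
    (∀ t, Integrable (K t) dsS2) ∧ Continuous fun t => ∫ y, K t y ∂dsS2 := by
  obtain ⟨C', hC', hcap⟩ := exists_cap_rpow_bound hp hp2
  have hd : ∀ t : T, Continuous fun y : S2 => ‖(π t : E3) - y‖ := fun t => by fun_prop
  -- The truncated kernels are continuous, so their integrals depend continuously on `t`. They
  -- differ from `K` only in a cap of radius `2 / (n + 1)`, so the cap estimate makes the
  -- convergence uniform in `t`.
  set θ : ℕ → T → S2 → F := fun n t y => diagCut n ‖(π t : E3) - y‖ • K t y with hθ
  have hθc : ∀ n, Continuous (Function.uncurry (θ n)) := by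
    intro n
    rw [continuous_iff_continuousAt]
    rintro ⟨t, y⟩
    have hc : Continuous fun z : T × S2 => ‖(π z.1 : E3) - z.2‖ := by fun_prop
    by_cases h : π t = y
    · have : ∀ᶠ z : T × S2 in 𝓝 (t, y), (n + 1) * ‖(π z.1 : E3) - z.2‖ < 1 :=
        (continuous_const.mul hc).continuousAt.eventually_lt continuousAt_const (by simp [h])
      refine (continuousAt_const (y := (0 : F))).congr ?_
      filter_upwards [this] with z hz
      simp [Function.uncurry, hθ, diagCut_eq_zero hz.le]
    · exact ((continuous_diagCut n).comp hc).continuousAt.smul (hK t y h)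
  -- Nothing is known about `K` on the diagonal. Points being null, `K t` is an almost everywhere
  -- limit of the continuous truncations.
  have hKm : ∀ t, AEStronglyMeasurable (K t) dsS2 := by
    intro t
    refine aestronglyMeasurable_of_tendsto_ae atTop (f := fun n y => θ n t y) (fun n => ?_) ?_
    · exact ((hθc n).comp (by fun_prop : Continuous fun y => (t, y))).aestronglyMeasurable
    · filter_upwards [ae_ne_dsS2 (π t)] with y hy
      have hpos : 0 < ‖(π t : E3) - y‖ := by
        rw [norm_pos_iff, sub_ne_zero]
        exact fun h => hy (Subtype.ext h.symm)
      refine tendsto_const_nhds.congr' ?_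
      have h1 : Tendsto (fun n : ℕ => 2 / ((n : ℝ) + 1)) atTop (𝓝 0) :=
        tendsto_two_div
      filter_upwards [h1.eventually_lt_const hpos] with n hn
      simp [hθ, diagCut_eq_one hn]
  have hKb : ∀ t, ∀ᵐ y ∂dsS2, ‖K t y‖ₑ ≤ ENNReal.ofReal C *
      ENNReal.ofReal (‖(π t : E3) - y‖ ^ (-p)) := by
    intro t
    filter_upwards [ae_ne_dsS2 (π t)] with y hy
    rw [← ENNReal.ofReal_mul hC, ← ofReal_norm]
    exact ENNReal.ofReal_le_ofReal (hb t y hy.symm)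
  have hset : ∀ (t : T) (δ : ℝ), 0 < δ → δ ≤ 4 →
      ∫⁻ y in {y : S2 | ‖(π t : E3) - y‖ ≤ δ}, ‖K t y‖ₑ ∂dsS2 ≤
        ENNReal.ofReal (C * (C' * δ ^ (2 - p))) := by
    intro t δ hδ hδ4
    refine (lintegral_mono_ae (ae_restrict_of_ae (hKb t))).trans ?_
    rw [lintegral_const_mul' _ _ ENNReal.ofReal_ne_top, ENNReal.ofReal_mul hC]
    exact mul_le_mul_right (hcap (π t) δ hδ hδ4) _
  have hint : ∀ t, Integrable (K t) dsS2 := by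
    intro t
    refine ⟨hKm t, ?_⟩
    have h1 := hset t 4 (by norm_num) le_rfl
    have h2 : {y : S2 | ‖(π t : E3) - y‖ ≤ 4} = univ := by
      ext y
      simp only [mem_ofPred_eq, mem_univ, iff_true]
      refine (norm_sub_le _ _).trans ?_
      rw [S2.norm_coe, S2.norm_coe]; norm_num
    rw [h2, Measure.restrict_univ] at h1
    exact h1.trans_lt ENNReal.ofReal_lt_top
  refine ⟨hint, ?_⟩
  have hcont : ∀ n, Continuous fun t => ∫ y, θ n t y ∂dsS2 := by
    intro n
    have := continuous_parametric_integral_of_continuous (μ := dsS2) (hθc n)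
      (isCompact_univ (X := S2))
    simpa using this
  have hθi : ∀ n t, Integrable (θ n t) dsS2 := by
    intro n t
    refine (hint t).mono
      (((hθc n).comp (by fun_prop : Continuous fun y => (t, y))).aestronglyMeasurable) ?_
    refine ae_of_all _ fun y => ?_
    simp only [hθ, norm_smul, Real.norm_of_nonneg (diagCut_nonneg _ _)]
    exact mul_le_of_le_one_left (norm_nonneg _) (diagCut_le_one _ _)
  refine TendstoUniformly.continuous (F := fun n t => ∫ y, θ n t y ∂dsS2) (p := atTop) ?_
    (Frequently.of_forall hcont)
  rw [Metric.tendstoUniformly_iff]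
  intro ε hε
  have hlim : Tendsto (fun n : ℕ => C * (C' * (2 / ((n : ℝ) + 1)) ^ (2 - p))) atTop (𝓝 0) := by
    have h1 : Tendsto (fun n : ℕ => 2 / ((n : ℝ) + 1)) atTop (𝓝 0) :=
      tendsto_two_div
    have h2 := h1.rpow_const (p := 2 - p) (Or.inr (by linarith))
    rw [Real.zero_rpow (by linarith)] at h2
    simpa using (h2.const_mul C').const_mul C
  filter_upwards [hlim.eventually_lt_const hε] with n hn t
  refine lt_of_le_of_lt ?_ hn
  have hδ : (0 : ℝ) < 2 / (n + 1) := by positivity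
  have hδ4 : (2 : ℝ) / (n + 1) ≤ 4 := by
    rw [div_le_iff₀ (by positivity)]
    have : (0 : ℝ) ≤ n := by positivity
    linarith
  rw [dist_eq_norm, ← integral_sub (hint t) (hθi n t)]
  have hm : MeasurableSet {y : S2 | ‖(π t : E3) - y‖ ≤ 2 / (n + 1)} :=
    (isClosed_le (hd t) continuous_const).measurableSet
  have h1 : ‖∫ y, K t y - θ n t y ∂dsS2‖ₑ ≤ ENNReal.ofReal (C * (C' * (2 / ((n : ℝ) + 1)) ^ (2 - p))) := by
    refine (enorm_integral_le_lintegral_enorm _).trans (le_trans ?_ (hset t _ hδ hδ4))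
    rw [← lintegral_indicator hm]
    refine lintegral_mono fun y => ?_
    by_cases hy : y ∈ {y : S2 | ‖(π t : E3) - y‖ ≤ 2 / (n + 1)}
    · rw [indicator_of_mem hy, enorm_le_iff_norm_le]
      have : K t y - θ n t y = (1 - diagCut n ‖(π t : E3) - y‖) • K t y := by
        simp only [hθ, sub_smul, one_smul]
      rw [this, norm_smul, Real.norm_of_nonneg (by linarith [diagCut_le_one n ‖(π t : E3) - y‖])]
      exact mul_le_of_le_one_left (norm_nonneg _)
        (by linarith [diagCut_nonneg n ‖(π t : E3) - y‖])
    · rw [indicator_of_notMem hy]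
      have : 2 / ((n : ℝ) + 1) < ‖(π t : E3) - y‖ := not_le.mp hy
      simp [hθ, diagCut_eq_one this]
  rw [← ofReal_norm] at h1
  exact (ENNReal.ofReal_le_ofReal_iff (by positivity)).mp h1

end SphereBIE

/-! ### Integration by parts on the sphere. -/

namespace SphereBIE

/-- The standard basis vectors of `ℝ³`. -/
noncomputable abbrev e3 (k : Fin 3) : E3 := EuclideanSpace.single k 1

theorem integral_fderiv_eq_zero {f : E3 → ℂ} (hf : ContDiff ℝ 1 f) (hs : HasCompactSupport f)
    (v : E3) : Integrable (fun x => fderiv ℝ f x v) ∧ ∫ x, fderiv ℝ f x v = 0 := by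
  have hc : Continuous fun x => fderiv ℝ f x v :=
    (hf.continuous_fderiv one_ne_zero).clm_apply continuous_const
  have hs' : HasCompactSupport fun x => fderiv ℝ f x v := hs.fderiv_apply (𝕜 := ℝ) v
  have hi : Integrable fun x => fderiv ℝ f x v := hc.integrable_of_hasCompactSupport hs'
  refine ⟨hi, ?_⟩
  have := integral_mul_fderiv_eq_neg_fderiv_mul_of_integrable (μ := (volume : Measure E3))
    (f := fun _ => (1 : ℂ)) (g := f) (v := v) (by simp) (by simpa using hi)
    (by simpa using hf.continuous.integrable_of_hasCompactSupport hs)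
    (fun x _ => differentiableAt_const _) (fun x _ => hf.differentiable one_ne_zero x)
  simpa using this

/-- The rotational vector field in the plane of the coordinates `b`, `k`. -/
noncomputable def rotField (b k : Fin 3) (x : E3) : E3 := x b • e3 k - x k • e3 b

theorem inner_rotField (b k : Fin 3) (x : E3) : inner ℝ x (rotField b k x) = 0 := by
  simp [rotField, inner_sub_right, inner_smul_right, EuclideanSpace.inner_single_right]
  ring

theorem fderiv_radial_rotField {F : Type*} [NormedAddCommGroup F] [NormedSpace ℝ F]
    {c : ℝ → F} (b k : Fin 3) {x : E3} (hc : DifferentiableAt ℝ c (‖x‖ ^ 2)) :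
    fderiv ℝ (fun w : E3 => c (‖w‖ ^ 2)) x (rotField b k x) = 0 := by
  have h1 : HasFDerivAt (fun w : E3 => ‖w‖ ^ 2) (2 • innerSL ℝ x) x :=
    (hasStrictFDerivAt_norm_sq x).hasFDerivAt
  have h2 := hc.hasFDerivAt.comp x h1
  have h3 : fderiv ℝ (fun w : E3 => c (‖w‖ ^ 2)) x = _ := h2.fderiv
  rw [h3]
  simp [inner_rotField]

/-- The rotational field is divergence free and annihilates the radial cut-off, so the integrand
equals `∂_k (cut x_b f) - ∂_b (cut x_k f)`, a difference of derivatives of compactly supported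
functions. -/
theorem integral_rotField {f : E3 → ℂ} (hf : ∀ x : E3, x ≠ 0 → ContDiffAt ℝ 1 f x)
    (b k : Fin 3) : ∫ x : E3, cut (‖x‖ ^ 2) • fderiv ℝ f x (rotField b k x) = 0 := by
  have hC : ∀ a : Fin 3, ContDiff ℝ 1 fun x : E3 => cut (‖x‖ ^ 2) • (x a • f x) := fun a =>
    contDiff_cut_smul (by simp) fun x hx =>
      (contDiffAt_euclidean.mp contDiffAt_id a).smul (hf x hx)
  have hS : ∀ a : Fin 3, HasCompactSupport fun x : E3 => cut (‖x‖ ^ 2) • (x a • f x) := fun a =>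
    hasCompactSupport_cut.smul_right
  obtain ⟨i1, z1⟩ := integral_fderiv_eq_zero (hC b) (hS b) (e3 k)
  obtain ⟨i2, z2⟩ := integral_fderiv_eq_zero (hC k) (hS k) (e3 b)
  rw [← sub_eq_zero.mpr (z1.trans z2.symm), ← integral_sub i1 i2]
  congr 1 with x
  by_cases hx : x = 0
  · subst hx
    have h0 : ∀ a : Fin 3, fderiv ℝ (fun x : E3 => cut (‖x‖ ^ 2) • (x a • f x)) 0 = 0 := by
      intro a
      have : (fun x : E3 => cut (‖x‖ ^ 2) • (x a • f x)) =ᶠ[𝓝 0] fun _ => (0 : ℂ) := by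
        filter_upwards [cut_eventually_zero] with x hx
        simp [hx]
      rw [this.fderiv_eq]
      simp
    rw [h0, h0, cut_eventually_zero.self_of_nhds]
    simp
  · have hd : ∀ a m : Fin 3, fderiv ℝ (fun x : E3 => cut (‖x‖ ^ 2) • (x a • f x)) x (e3 m) =
        cut (‖x‖ ^ 2) • (x a • fderiv ℝ f x (e3 m) + (e3 m) a • f x) +
          fderiv ℝ (fun x : E3 => cut (‖x‖ ^ 2)) x (e3 m) • (x a • f x) := by
      intro a m
      have h1 : HasFDerivAt (fun w : E3 => w a) (EuclideanSpace.proj a : E3 →L[ℝ] ℝ) x :=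
        (EuclideanSpace.proj a : E3 →L[ℝ] ℝ).hasFDerivAt
      have h2 := h1.fun_smul ((hf x hx).differentiableAt one_ne_zero).hasFDerivAt
      have h3 := ((contDiff_cut.differentiable (by simp)) x).hasFDerivAt.fun_smul h2
      rw [h3.fderiv]
      simp
    have hrad := fderiv_radial_rotField (c := cut) b k (x := x)
      (cut.contDiff.differentiable (n := ∞) (by simp) _)
    rw [hd, hd]
    simp only [rotField, map_sub, map_smul] at hrad ⊢
    have hsym : (e3 k) b = (e3 b) k := by
      simp [eq_comm]
    rw [hsym]
    simp only [smul_eq_mul, Complex.real_smul] at hrad ⊢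
    have hrad' := congrArg (fun r : ℝ => (r : ℂ)) hrad
    push_cast at hrad'
    linear_combination (-f x) * hrad'

/-- Polar coordinates: the angular and the radial factor separate. This transfers integral
identities from `ℝ³` to the sphere. -/
theorem integral_cut_radialExt (s : S2 → ℂ) :
    ∫ x : E3, cut (‖x‖ ^ 2) • radialExt s x = (∫ x, s x ∂dsS2) *
      ∫ r : Ioi (0 : ℝ), ((cut ((r : ℝ) ^ 2) : ℝ) : ℂ) ∂(Measure.volumeIoiPow 2) := by
  have h1 := (volume : Measure E3).measurePreserving_homeomorphUnitSphereProd
  have h2 := h1.integral_comp (Homeomorph.measurableEmbedding _)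
    (fun z : S2 × Ioi (0 : ℝ) => s z.1 * ((cut ((z.2 : ℝ) ^ 2) : ℝ) : ℂ))
  rw [finrank_euclideanSpace_fin] at h2
  have h3 := integral_prod_mul (μ := dsS2) (ν := Measure.volumeIoiPow 2) s
    (fun r : Ioi (0 : ℝ) => ((cut ((r : ℝ) ^ 2) : ℝ) : ℂ))
  rw [← h3]
  refine Eq.trans ?_ h2
  have h4 := integral_subtype_comap (μ := (volume : Measure E3))
    (measurableSet_singleton (0 : E3)).compl fun x : E3 => cut (‖x‖ ^ 2) • radialExt s x
  rw [restrict_compl_singleton] at h4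
  rw [← h4]
  refine integral_congr_ae (ae_of_all _ fun x => ?_)
  have hx : (x : E3) ≠ 0 := x.2
  simp only [homeomorphUnitSphereProd_apply_snd_coe, Complex.real_smul]
  have h5 : toS2 x hx = (homeomorphUnitSphereProd E3 x).1 := Subtype.ext (by simp [toS2])
  rw [radialExt_of_ne s hx, mul_comm, h5]

/-- With `s = 1` in `integral_cut_radialExt`, a zero weight would force the integral of the
nonnegative, nonzero cut-off to vanish. -/
theorem radial_weight_ne_zero :
    ∫ r : Ioi (0 : ℝ), ((cut ((r : ℝ) ^ 2) : ℝ) : ℂ) ∂(Measure.volumeIoiPow 2) ≠ 0 := by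
  intro h
  have h1 := integral_cut_radialExt fun _ => 1
  rw [h, mul_zero] at h1
  have h2 : ∀ x : E3, cut (‖x‖ ^ 2) • radialExt (fun _ : S2 => (1 : ℂ)) x =
      ((cut (‖x‖ ^ 2) : ℝ) : ℂ) := by
    intro x
    by_cases hx : x = 0
    · subst hx
      rw [cut_eventually_zero.self_of_nhds]
      simp
    · rw [radialExt_of_ne _ hx]
      simp
  simp_rw [h2] at h1
  rw [integral_complex_ofReal, Complex.ofReal_eq_zero] at h1
  have h3 : 0 < ∫ x : E3, cut (‖x‖ ^ 2) :=
    contDiff_cut.continuous.integral_pos_of_hasCompactSupport_nonneg_nonzero hasCompactSupport_cut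
      (fun x => cut.nonneg) (x := e3 0) (by 
        have := cut.one_of_mem_closedBall (x := 1) (by simp [cut])
        simp [this])
  exact h3.ne' h1

/-- The integral over the sphere of a rotational derivative vanishes. -/
theorem integral_sphere_rotField {f : E3 → ℂ} (hf : ∀ x : S2, ContDiffAt ℝ 1 f (x : E3))
    (b k : Fin 3) : ∫ x : S2, fderiv ℝ f (x : E3) (rotField b k x) ∂dsS2 = 0 := by
  set s : S2 → ℂ := fun x => f x with hs
  have hP : ∀ x : E3, x ≠ 0 → ContDiffAt ℝ 1 (fun z : E3 => ‖z‖⁻¹ • z) x := fun x hx =>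
    ((contDiffAt_norm ℝ hx).inv (norm_ne_zero_iff.mpr hx)).smul contDiffAt_id
  have heq : ∀ x : E3, x ≠ 0 → radialExt s =ᶠ[𝓝 x] fun z : E3 => f (‖z‖⁻¹ • z) := by
    intro x hx
    filter_upwards [isOpen_compl_singleton.mem_nhds hx] with z hz
    rw [radialExt_of_ne _ hz]
    rfl
  have hsm : ∀ x : E3, x ≠ 0 → ContDiffAt ℝ 1 (radialExt s) x := fun x hx =>
    (ContDiffAt.comp x (g := f) (hf (toS2 x hx)) (hP x hx)).congr_of_eventuallyEq (heq x hx)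
  have hrot := integral_rotField hsm b k
  -- The field is tangent to spheres, so the derivative of the factor `‖x‖⁻¹` along it vanishes, and
  -- it is linear in `x`. Hence the rotational derivative of the extension is the extension of the
  -- rotational derivative of `f`.
  have hext : ∀ x : E3, cut (‖x‖ ^ 2) • fderiv ℝ (radialExt s) x (rotField b k x) =
      cut (‖x‖ ^ 2) • radialExt (fun x : S2 => fderiv ℝ f (x : E3) (rotField b k x)) x := by
    intro x
    by_cases hx : x = 0
    · subst hx
      rw [cut_eventually_zero.self_of_nhds]
      simp
    · congr 1
      rw [(heq x hx).fderiv_eq, radialExt_of_ne _ hx]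
      have hd : HasFDerivAt f (fderiv ℝ f (toS2 x hx)) (‖x‖⁻¹ • x) :=
        ((hf (toS2 x hx)).differentiableAt one_ne_zero).hasFDerivAt
      have hn : HasFDerivAt (fun z : E3 => ‖z‖⁻¹) (fderiv ℝ (fun z : E3 => ‖z‖⁻¹) x) x :=
        (((contDiffAt_norm (n := 1) ℝ hx).inv (norm_ne_zero_iff.mpr hx)).differentiableAt
          one_ne_zero).hasFDerivAt
      have hn0 : fderiv ℝ (fun z : E3 => ‖z‖⁻¹) x (rotField b k x) = 0 := by
        have hx2 : ‖x‖ ^ 2 ≠ 0 := by simpa using hx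
        have h3 : (fun z : E3 => ‖z‖⁻¹) = fun z : E3 => (√(‖z‖ ^ 2))⁻¹ := by
          ext z; rw [Real.sqrt_sq (norm_nonneg _)]
        rw [h3]
        exact fderiv_radial_rotField (c := fun t => (√t)⁻¹) b k
          ((differentiableAt_id.sqrt hx2).inv (by simpa using hx))
      have h4 := (HasFDerivAt.comp (f := fun z : E3 => ‖z‖⁻¹ • z) x hd
        (hn.fun_smul (hasFDerivAt_id x))).fderiv
      have h5 : fderiv ℝ (fun z : E3 => f (‖z‖⁻¹ • z)) x = _ := h4
      rw [h5]
      simp only [ContinuousLinearMap.comp_apply, add_apply,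
        smul_apply, ContinuousLinearMap.smulRight_apply, hn0, zero_smul,
        add_zero, ContinuousLinearMap.id_apply]
      congr 1
      simp [rotField, toS2, smul_sub, smul_smul]
  simp_rw [hext] at hrot
  rw [integral_cut_radialExt] at hrot
  rcases mul_eq_zero.mp hrot with h | h
  · exact h
  · exact absurd h radial_weight_ne_zero

end SphereBIE

/-! ### Stokes' theorem on a surface parametrized by the sphere. -/

namespace SphereBIE

section Stokes

variable {p : S2 → E3} {B : E3 → C3} {ψ : S2 → ℂ}

/-- The components of the pull-back of the covector field `ψ B` to the sphere. -/
noncomputable def pullComp (p : S2 → E3) (B : E3 → C3) (ψ : S2 → ℂ) (a : Fin 3) (x : E3) : ℂ :=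
  radialExt ψ x * ∑ i, B (radialExt p x) i * (jacEntry p i a x : ℂ)

theorem contDiffAt_pullComp (hp : SmoothExt p) (hB : ∀ x, ContDiffAt ℝ 1 B (p x))
    (hψ : SmoothExt ψ) (a : Fin 3) (x : S2) : ContDiffAt ℝ 1 (pullComp p B ψ a) (x : E3) := by
  have hx := S2.coe_ne_zero x
  have h1 : ContDiffAt ℝ 1 (radialExt ψ) (x : E3) := (hψ x hx).of_le (by simp)
  have h2 : ContDiffAt ℝ 1 (fun w => B (radialExt p w)) (x : E3) :=
    ContDiffAt.comp (x : E3) (by rw [radialExt_coe]; exact hB x) ((hp x hx).of_le (by simp))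
  have h3 : ∀ i, ContDiffAt ℝ 1 (fun w => B (radialExt p w) i) (x : E3) := contDiffAt_pi.mp h2
  have h4 : ∀ i, ContDiffAt ℝ 1 (fun w => (jacEntry p i a w : ℂ)) (x : E3) := fun i =>
    Complex.ofRealCLM.contDiff.contDiffAt.comp (x : E3) ((hp.jacEntry i a hx).of_le (by simp))
  exact h1.mul (ContDiffAt.sum fun i _ => (h3 i).mul (h4 i))

theorem fderiv_jacEntry_symm (hp : SmoothExt p) (i a k : Fin 3) {x : E3} (hx : x ≠ 0) :
    fderiv ℝ (jacEntry p i a) x (e3 k) = fderiv ℝ (jacEntry p i k) x (e3 a) := by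
  have hd : DifferentiableAt ℝ (fderiv ℝ (radialExt p)) x :=
    ((hp x hx).fderiv_right (m := ∞) (by simp)).differentiableAt (by simp)
  have h1 : ∀ b m : Fin 3, fderiv ℝ (jacEntry p i b) x (e3 m) =
      (fderiv ℝ (fderiv ℝ (radialExt p)) x (e3 m) (e3 b)) i := by
    intro b m
    have h2 := hd.hasFDerivAt.clm_apply (hasFDerivAt_const (e3 b) x)
    have h3 := (EuclideanSpace.proj i : E3 →L[ℝ] ℝ).hasFDerivAt.comp x h2
    have h4 : fderiv ℝ (jacEntry p i b) x = _ := h3.fderiv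
    rw [h4]
    simp
  rw [h1, h1]
  have := (hp x hx).isSymmSndFDerivAt (by
    simpa using WithTop.coe_le_coe.mpr (le_top : (2 : ℕ∞) ≤ ⊤)) (e3 k) (e3 a)
  rw [this]

theorem fderiv_eq_sum_pd {W : E3 → C3} {z : E3} (v : E3) (i : Fin 3) :
    fderiv ℝ W z v i = ∑ m, (v m : ℂ) * pd W z m i := by
  have hv : v = ∑ j, v j • EuclideanSpace.single j (1 : ℝ) := by
    ext i
    simp [Finset.sum_apply, Pi.single_apply]
  conv_lhs => rw [hv]
  simp [pd]

theorem fderiv_pullComp (hp : SmoothExt p) (hB : ∀ x, ContDiffAt ℝ 1 B (p x))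
    (hψ : SmoothExt ψ) (a k : Fin 3) (x : S2) :
    fderiv ℝ (pullComp p B ψ a) (x : E3) (e3 k) =
      gradS2 ψ x k * ∑ i, B (p x) i * (jacEntry p i a x : ℂ) +
      ψ x * ∑ i, (B (p x) i * (fderiv ℝ (jacEntry p i a) x (e3 k) : ℂ) +
        (∑ m, (jacEntry p m k x : ℂ) * pd B (p x) m i) * (jacEntry p i a x : ℂ)) := by
  have hx := S2.coe_ne_zero x
  have h1 := ((hψ x hx).differentiableAt (by simp)).hasFDerivAt
  have h2 := ((hp x hx).differentiableAt (by simp)).hasFDerivAt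
  have h2' : HasFDerivAt B (fderiv ℝ B (p x)) (radialExt p (x : E3)) := by
    rw [radialExt_coe]; exact ((hB x).differentiableAt one_ne_zero).hasFDerivAt
  have h3 : ∀ i : Fin 3, HasFDerivAt (fun w => B (radialExt p w) i)
      ((ContinuousLinearMap.proj i : C3 →L[ℝ] ℂ).comp
        ((fderiv ℝ B (p x)).comp (fderiv ℝ (radialExt p) (x : E3)))) (x : E3) := fun i =>
    (ContinuousLinearMap.proj i : C3 →L[ℝ] ℂ).hasFDerivAt.comp (x : E3) (h2'.comp (x : E3) h2)
  have h4 : ∀ i, HasFDerivAt (fun w => (jacEntry p i a w : ℂ))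
      (Complex.ofRealCLM.comp (fderiv ℝ (jacEntry p i a) (x : E3))) (x : E3) := fun i =>
    Complex.ofRealCLM.hasFDerivAt.comp (x : E3)
      ((hp.jacEntry i a hx).differentiableAt (by simp)).hasFDerivAt
  have h5 := h1.fun_mul (HasFDerivAt.fun_sum (u := Finset.univ)
    fun i _ => (h3 i).fun_mul (h4 i))
  have h6 : fderiv ℝ (pullComp p B ψ a) (x : E3) = _ := h5.fderiv
  rw [h6]
  simp only [add_apply, smul_apply, radialExt_coe, ContinuousLinearMap.comp_apply,
    ContinuousLinearMap.proj_apply, fderiv_eq_sum_pd, sum_apply, smul_eq_mul,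
    Complex.ofRealCLM_apply]
  rw [gradS2, add_comm, mul_comm (fderiv ℝ (radialExt ψ) (x : E3) (e3 k))]
  congr 2
  refine Finset.sum_congr rfl fun i _ => ?_
  rw [mul_comm (jacEntry p i a x : ℂ)]
  rfl

/-- Stokes' theorem, pointwise: the rotational derivatives of the pull-back. -/
theorem rot_pullComp (hp : SmoothExt p) (hB : ∀ x, ContDiffAt ℝ 1 B (p x))
    (hψ : SmoothExt ψ) (x : S2) :
    fderiv ℝ (pullComp p B ψ 2) (x : E3) (rotField 0 1 x) +
      fderiv ℝ (pullComp p B ψ 1) (x : E3) (rotField 2 0 x) +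
      fderiv ℝ (pullComp p B ψ 0) (x : E3) (rotField 1 2 x) =
    (cvec (areaVec p x) ⬝ᵥ curl B (p x)) * ψ x - B (p x) ⬝ᵥ DcurlS2 p ψ x := by
  have hx := S2.coe_ne_zero x
  have hs := fun i a k => congrArg (fun r : ℝ => (r : ℂ)) (fderiv_jacEntry_symm hp i a k hx)
  simp only [rotField, map_sub, map_smul, fderiv_pullComp hp hB hψ, Complex.real_smul]
  simp only [Fin.sum_univ_three, DcurlS2, curlS2, areaVec, cvec, curl, dotProduct, Matrix.mulVec,
    Matrix.adjugate_fin_three, cross_apply, Matrix.transpose_apply, Matrix.of_apply,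
    Matrix.cons_val', Matrix.cons_val_zero, Matrix.cons_val_one, Matrix.cons_val, Matrix.map_apply,
    DS2_apply, Fin.isValue, Complex.ofReal_add, Complex.ofReal_mul, Complex.ofReal_sub,
    Complex.ofReal_neg]
  have s01 := fun i => hs i 0 1
  have s02 := fun i => hs i 0 2
  have s12 := fun i => hs i 1 2
  -- The left side is `x̂ · curl` of the pulled-back covector field. By symmetry of second
  -- derivatives the terms with second derivatives of `p` cancel; the rest is polynomial algebra.
  rw [s01 0, s01 1, s01 2, s02 0, s02 1, s02 2, s12 0, s12 1, s12 2]
  ring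

theorem continuous_DS2 (hp : SmoothExt p) (i j : Fin 3) : Continuous fun x => DS2 p x i j := by
  simp only [DS2_apply]
  rw [continuous_iff_continuousAt]
  intro x
  exact (hp.jacEntry i j (S2.coe_ne_zero x)).continuousAt.comp continuous_subtype_val.continuousAt

theorem continuous_cvec : Continuous cvec := by
  unfold cvec
  fun_prop

theorem continuous_curlS2 (hψ : SmoothExt ψ) : Continuous (curlS2 ψ) := by
  have h1 : ∀ k, Continuous fun x => gradS2 ψ x k := by
    intro k
    rw [continuous_iff_continuousAt]
    intro x
    have h2 : ContinuousAt (fun w => fderiv ℝ (radialExt ψ) w (e3 k)) (x : E3) :=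
      (((hψ x (S2.coe_ne_zero x)).fderiv_right (m := ∞) (by simp)).clm_apply
        contDiffAt_const).continuousAt
    exact h2.comp continuous_subtype_val.continuousAt
  have h3 : ∀ k, Continuous fun x : S2 => cvec (x : E3) k := fun k => by unfold cvec; fun_prop
  refine continuous_pi fun i => ?_
  fin_cases i <;> simp only [curlS2, cross_apply] <;>
  · simp
    fun_prop

theorem continuous_DcurlS2 (hp : SmoothExt p) (hψ : SmoothExt ψ) :
    Continuous (DcurlS2 p ψ) := by
  have h1 := fun i j => continuous_DS2 hp i j
  have h2 := fun i => (continuous_apply i).comp (continuous_curlS2 hψ)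
  refine continuous_pi fun i => ?_
  simp only [DcurlS2, Matrix.mulVec, dotProduct, Matrix.map_apply]
  exact continuous_finsetSum _ fun j _ =>
    (Complex.continuous_ofReal.comp (h1 i j)).mul (h2 j)

theorem continuousAt_curl {W : E3 → C3} {z : E3} (hW : ContDiffAt ℝ 1 W z) :
    ContinuousAt (curl W) z := by
  have h1 : ContinuousAt (fderiv ℝ W) z :=
    (hW.fderiv_right (m := 0) (by simp)).continuousAt
  have h2 : ∀ j i, ContinuousAt (fun z => pd W z j i) z := fun j i =>
    (continuous_apply i).continuousAt.comp (h1.clm_apply continuousAt_const)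
  rw [continuousAt_pi]
  intro i
  fin_cases i
  · exact (h2 1 2).sub (h2 2 1)
  · exact (h2 2 0).sub (h2 0 2)
  · exact (h2 0 1).sub (h2 1 0)

theorem Continuous.integrable_dsS2 {F : Type*} [NormedAddCommGroup F] {f : S2 → F}
    (hf : Continuous f) : Integrable f dsS2 :=
  hf.integrable_of_hasCompactSupport (HasCompactSupport.of_compactSpace f)

theorem Continuous.dotProduct_fin {X : Type*} [TopologicalSpace X] {u v : X → C3}
    (hu : Continuous u) (hv : Continuous v) : Continuous fun x => u x ⬝ᵥ v x := by
  simp only [dotProduct]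
  fun_prop

theorem continuous_curl_comp (hp : Continuous p) (hB : ∀ x, ContDiffAt ℝ 1 B (p x)) :
    Continuous fun x => curl B (p x) :=
  continuous_iff_continuousAt.mpr fun x =>
    ContinuousAt.comp (continuousAt_curl (hB x)) hp.continuousAt

/-- Stokes' theorem on a parametrized surface, in weak form. -/
theorem stokes (hp : SmoothExt p) (hB : ∀ x, ContDiffAt ℝ 1 B (p x)) (hψ : SmoothExt ψ) :
    ∫ x, (cvec (areaVec p x) ⬝ᵥ curl B (p x)) * ψ x ∂dsS2 =
      ∫ x, B (p x) ⬝ᵥ DcurlS2 p ψ x ∂dsS2 := by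
  have hBp : Continuous fun x => B (p x) :=
    continuous_iff_continuousAt.mpr fun x =>
      ContinuousAt.comp (hB x).continuousAt hp.continuous.continuousAt
  have i1 : Integrable (fun x => (cvec (areaVec p x) ⬝ᵥ curl B (p x)) * ψ x) dsS2 :=
    Continuous.integrable_dsS2 ((Continuous.dotProduct_fin
      (continuous_cvec.comp hp.areaVec.continuous)
      (continuous_curl_comp hp.continuous hB)).mul hψ.continuous)
  have i2 : Integrable (fun x => B (p x) ⬝ᵥ DcurlS2 p ψ x) dsS2 :=
    Continuous.integrable_dsS2 (Continuous.dotProduct_fin hBp (continuous_DcurlS2 hp hψ))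
  rw [← sub_eq_zero, ← integral_sub i1 i2]
  have hi : ∀ a b k, Integrable
      (fun x : S2 => fderiv ℝ (pullComp p B ψ a) (x : E3) (rotField b k x)) dsS2 := by
    intro a b k
    refine Continuous.integrable_dsS2 (continuous_iff_continuousAt.mpr fun x => ?_)
    have h1 : ContinuousAt (fderiv ℝ (pullComp p B ψ a)) (x : E3) :=
      ((contDiffAt_pullComp hp hB hψ a x).fderiv_right (m := 0) (by simp)).continuousAt
    have h2 : Continuous (rotField b k) := by unfold rotField; fun_prop
    exact ContinuousAt.comp (f := ((↑) : S2 → E3)) (h1.clm_apply h2.continuousAt)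
      continuous_subtype_val.continuousAt
  have hz := fun a => integral_sphere_rotField (contDiffAt_pullComp hp hB hψ a)
  -- The difference of the two integrands is a sum of three rotational derivatives, each with
  -- integral zero.
  simp_rw [← rot_pullComp hp hB hψ]
  rw [integral_add ((hi 2 0 1).fun_add (hi 1 2 0)) (hi 0 1 2), integral_add (hi _ _ _) (hi _ _ _),
    hz, hz, hz]
  simp

end Stokes

end SphereBIE

/-! ### The fundamental solution and the potential off the surface. -/

namespace SphereBIE

section Kernel

/-- The fundamental solution as a function of `x - y`. -/
noncomputable def phi (κ : ℝ) (w : E3) : ℂ := Phi κ w 0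

theorem Phi_eq (κ : ℝ) (x y : E3) : Phi κ x y = phi κ (x - y) := by simp [phi, Phi]

/-- The radial profile of the fundamental solution. -/
noncomputable def phiRad (κ r : ℝ) : ℂ :=
  (1 / (4 * (Real.pi : ℂ))) * (Complex.exp (Complex.I * κ * (r : ℂ)) / (r : ℂ))

theorem phi_eq_rad (κ : ℝ) : phi κ = fun w => phiRad κ ‖w‖ := by
  ext w
  simp [phi, Phi, phiRad]

theorem contDiffAt_phiRad (κ : ℝ) {r : ℝ} (hr : r ≠ 0) : ContDiffAt ℝ ∞ (phiRad κ) r := by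
  have h1 : ContDiffAt ℝ ∞ (fun r : ℝ => (r : ℂ)) r := Complex.ofRealCLM.contDiff.contDiffAt
  have h2 : phiRad κ = fun r : ℝ => (1 / (4 * (Real.pi : ℂ))) *
      (Complex.exp (Complex.I * κ * (r : ℂ)) * (r : ℂ)⁻¹) := by
    ext r
    rw [phiRad, div_eq_mul_inv (Complex.exp _)]
  rw [h2]
  have hr' : (r : ℂ) ≠ 0 := by exact_mod_cast hr
  exact contDiffAt_const.mul (((contDiffAt_const.mul h1).cexp).mul (h1.inv hr'))

theorem norm_exp_phase (κ r : ℝ) : ‖Complex.exp (Complex.I * κ * (r : ℂ))‖ = 1 := by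
  have : Complex.I * κ * (r : ℂ) = ((κ * r : ℝ) : ℂ) * Complex.I := by push_cast; ring
  rw [this, Complex.norm_exp_ofReal_mul_I]

theorem norm_phi_const_le : ‖(1 / (4 * (Real.pi : ℂ)))‖ ≤ 1 := by
  have h : (1 / (4 * (Real.pi : ℂ))) = ((1 / (4 * Real.pi) : ℝ) : ℂ) := by push_cast; ring
  rw [h, Complex.norm_real, Real.norm_of_nonneg (by positivity), div_le_one (by positivity)]
  linarith [Real.pi_gt_three]

theorem norm_phi_le (κ : ℝ) (w : E3) : ‖phi κ w‖ ≤ ‖w‖⁻¹ := by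
  rw [phi_eq_rad]
  simp only [phiRad]
  rw [norm_mul, norm_div (Complex.exp _), norm_exp_phase, Complex.norm_real, norm_norm,
    one_div ‖w‖]
  exact mul_le_of_le_one_left (by positivity) norm_phi_const_le

theorem norm_deriv_phiRad_le (κ : ℝ) {r : ℝ} (hr : 0 < r) :
    ‖deriv (phiRad κ) r‖ ≤ |κ| * r⁻¹ + (r ^ 2)⁻¹ := by
  have hr' : (r : ℂ) ≠ 0 := by exact_mod_cast hr.ne'
  have h1 : HasDerivAt (fun r : ℝ => (r : ℂ)) 1 r := Complex.ofRealCLM.hasDerivAt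
  have h2 := ((h1.const_mul (Complex.I * κ)).cexp.fun_div h1 hr').const_mul
    (1 / (4 * (Real.pi : ℂ)))
  have h3 : deriv (phiRad κ) r = _ := h2.deriv
  rw [h3, norm_mul]
  refine (mul_le_of_le_one_left (norm_nonneg _) norm_phi_const_le).trans ?_
  rw [norm_div, norm_pow, Complex.norm_real, Real.norm_of_nonneg hr.le, div_le_iff₀ (by positivity)]
  refine (norm_sub_le _ _).trans ?_
  have h4 : ‖Complex.I * (κ : ℂ) * 1‖ = |κ| := by simp
  rw [norm_mul, norm_mul, norm_exp_phase, Complex.norm_real, Real.norm_of_nonneg hr.le, h4, mul_one,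
    norm_exp_phase]
  have h5 : (|κ| * r⁻¹ + (r ^ 2)⁻¹) * r ^ 2 = |κ| * r + 1 := by field_simp
  rw [h5]
  linarith

theorem contDiffAt_phi (κ : ℝ) {w : E3} (hw : w ≠ 0) : ContDiffAt ℝ ∞ (phi κ) w := by
  rw [phi_eq_rad]
  exact (contDiffAt_phiRad κ (norm_ne_zero_iff.mpr hw)).comp w (contDiffAt_norm ℝ hw)

theorem hasFDerivAt_phi (κ : ℝ) {w : E3} (hw : w ≠ 0) :
    HasFDerivAt (phi κ) (fderiv ℝ (phi κ) w) w :=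
  ((contDiffAt_phi κ hw).differentiableAt (by simp)).hasFDerivAt

theorem continuousAt_fderiv_phi (κ : ℝ) {w : E3} (hw : w ≠ 0) :
    ContinuousAt (fderiv ℝ (phi κ)) w :=
  ((contDiffAt_phi κ hw).fderiv_right (m := ∞) (by simp)).continuousAt

theorem norm_fderiv_phi_le (κ : ℝ) {w : E3} (hw : w ≠ 0) :
    ‖fderiv ℝ (phi κ) w‖ ≤ |κ| * ‖w‖⁻¹ + (‖w‖ ^ 2)⁻¹ := by
  have h1 : HasDerivAt (phiRad κ) (deriv (phiRad κ) ‖w‖) ‖w‖ :=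
    ((contDiffAt_phiRad κ (norm_ne_zero_iff.mpr hw)).differentiableAt (by simp)).hasDerivAt
  have h2 : HasFDerivAt (fun v : E3 => ‖v‖) (fderiv ℝ (fun v : E3 => ‖v‖) w) w :=
    ((contDiffAt_norm (n := 1) ℝ hw).differentiableAt one_ne_zero).hasFDerivAt
  have h3 := h1.hasFDerivAt.comp w h2
  have h4 := h3.fderiv
  rw [show phiRad κ ∘ norm = phi κ from (phi_eq_rad κ).symm] at h4
  rw [h4]
  refine (ContinuousLinearMap.opNorm_comp_le _ _).trans ?_
  have h5 : ‖fderiv ℝ (fun v : E3 => ‖v‖) w‖ ≤ 1 := by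
    simpa using norm_fderiv_le_of_lipschitz ℝ (lipschitzWith_one_norm (E := E3)) (x₀ := w)
  refine (mul_le_of_le_one_right (norm_nonneg _) h5).trans ?_
  simpa using norm_deriv_phiRad_le κ (norm_pos_iff.mpr hw)

/-- The gradient of the fundamental solution. -/
noncomputable def gphi (κ : ℝ) (w : E3) : C3 := fun j => fderiv ℝ (phi κ) w (e3 j)

theorem norm_gphi_le (κ : ℝ) {w : E3} (hw : w ≠ 0) :
    ‖gphi κ w‖ ≤ |κ| * ‖w‖⁻¹ + (‖w‖ ^ 2)⁻¹ := by
  refine (pi_norm_le_iff_of_nonneg (by positivity)).mpr fun j => ?_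
  refine le_trans ?_ (norm_fderiv_phi_le κ hw)
  simpa [gphi] using (fderiv ℝ (phi κ) w).le_opNorm (e3 j)

theorem continuousAt_gphi (κ : ℝ) {w : E3} (hw : w ≠ 0) : ContinuousAt (gphi κ) w :=
  continuousAt_pi.mpr fun _ => (continuousAt_fderiv_phi κ hw).clm_apply continuousAt_const

end Kernel

section VectorBounds

theorem norm_dotProduct_le (u v : C3) : ‖u ⬝ᵥ v‖ ≤ 3 * (‖u‖ * ‖v‖) := by
  rw [dotProduct]
  refine (norm_sum_le _ _).trans ?_
  refine (Finset.sum_le_sum fun i _ => (?_ : ‖u i * v i‖ ≤ ‖u‖ * ‖v‖)).trans (by simp)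
  rw [norm_mul]
  exact mul_le_mul (norm_le_pi_norm u i) (norm_le_pi_norm v i) (norm_nonneg _) (norm_nonneg _)

theorem norm_cross_le (u v : C3) : ‖u ⨯₃ v‖ ≤ 2 * (‖u‖ * ‖v‖) := by
  have h : ∀ i j k l, ‖u i * v j - u k * v l‖ ≤ 2 * (‖u‖ * ‖v‖) := by
    intro i j k l
    have h1 : ∀ i j, ‖u i * v j‖ ≤ ‖u‖ * ‖v‖ := fun i j => by
      rw [norm_mul]
      exact mul_le_mul (norm_le_pi_norm u i) (norm_le_pi_norm v j) (norm_nonneg _) (norm_nonneg _)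
    refine (norm_sub_le _ _).trans ?_
    linarith [h1 i j, h1 k l]
  refine (pi_norm_le_iff_of_nonneg (by positivity)).mpr fun i => ?_
  fin_cases i
  · exact h 1 2 2 1
  · exact h 2 0 0 2
  · exact h 0 1 1 0

theorem norm_triple_le (u v w : C3) : ‖u ⬝ᵥ (v ⨯₃ w)‖ ≤ 6 * (‖u‖ * ‖v‖ * ‖w‖) := by
  refine (norm_dotProduct_le _ _).trans ?_
  nlinarith [mul_le_mul_of_nonneg_left (norm_cross_le v w) (norm_nonneg u)]

theorem norm_cvec_le (v : E3) : ‖cvec v‖ ≤ ‖v‖ := by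
  refine (pi_norm_le_iff_of_nonneg (norm_nonneg _)).mpr fun i => ?_
  rw [cvec, Complex.norm_real]
  exact PiLp.norm_apply_le v i

theorem cvec_sub (u v : E3) : cvec (u - v) = cvec u - cvec v := by
  ext i; simp [cvec]

theorem cvec_smul (r : ℝ) (v : E3) : cvec (r • v) = (r : ℂ) • cvec v := by
  ext i; simp [cvec]

theorem cvec_add (u v : E3) : cvec (u + v) = cvec u + cvec v := by
  ext i; simp [cvec]

end VectorBounds

section Potential

variable {q : S2 → E3} {κ : ℝ} {g : E3 → C3}

theorem exists_ball_dist_range (hq : Continuous q) {z₀ : E3} (hz : z₀ ∉ range q) :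
    ∃ d : ℝ, 0 < d ∧ ∀ z ∈ Metric.ball z₀ d, ∀ y, d ≤ ‖z - q y‖ := by
  have hcl : IsClosed (range q) := (isCompact_range hq).isClosed
  obtain ⟨ε, hε, h⟩ := Metric.isOpen_iff.mp hcl.isOpen_compl z₀ hz
  refine ⟨ε / 2, by positivity, fun z hz y => ?_⟩
  by_contra! hlt
  have h1 : q y ∈ Metric.ball z₀ ε := by
    rw [Metric.mem_ball, dist_comm]
    have := dist_triangle z₀ z (q y)
    rw [Metric.mem_ball, dist_comm] at hz
    rw [← dist_eq_norm] at hlt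
    linarith
  exact h h1 (mem_range_self y)

/-- The potential of a density on the sphere. -/
noncomputable def pot (q : S2 → E3) (κ : ℝ) (H : S2 → C3) (z : E3) : C3 :=
  ∫ y, phi κ (z - q y) • H y ∂dsS2

/-- The derivative of the potential. -/
noncomputable def dpot (q : S2 → E3) (κ : ℝ) (H : S2 → C3) (z : E3) : E3 →L[ℝ] C3 :=
  ∫ y, (fderiv ℝ (phi κ) (z - q y)).smulRight (H y) ∂dsS2

variable {H : S2 → C3}

theorem sub_ne_zero_of_notMem {z : E3} (hz : z ∉ range q) (y : S2) : z - q y ≠ 0 :=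
  sub_ne_zero.mpr fun h => hz ⟨y, h.symm⟩

theorem norm_smulRight_le (L : E3 →L[ℝ] ℂ) (v : C3) : ‖L.smulRight v‖ ≤ ‖L‖ * ‖v‖ := by
  refine ContinuousLinearMap.opNorm_le_bound _ (by positivity) fun u => ?_
  rw [ContinuousLinearMap.smulRight_apply, norm_smul]
  nlinarith [mul_le_mul_of_nonneg_right (L.le_opNorm u) (norm_nonneg v)]

theorem continuous_dpot_integrand (hq : Continuous q) (hH : Continuous H) {z : E3}
    (hz : z ∉ range q) :
    Continuous fun y => (fderiv ℝ (phi κ) (z - q y)).smulRight (H y) := by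
  have h1 : Continuous fun y => fderiv ℝ (phi κ) (z - q y) := by
    rw [continuous_iff_continuousAt]
    intro y
    exact ContinuousAt.comp (f := fun y => z - q y)
      (continuousAt_fderiv_phi κ (sub_ne_zero_of_notMem hz y))
      (continuous_const.sub hq).continuousAt
  exact continuous_clm_apply.mpr fun v => (h1.clm_apply continuous_const).smul hH

theorem continuous_pot_integrand (hq : Continuous q) (hH : Continuous H) {z : E3}
    (hz : z ∉ range q) : Continuous fun y => phi κ (z - q y) • H y := by
  have h1 : Continuous fun y => phi κ (z - q y) := by
    rw [continuous_iff_continuousAt]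
    intro y
    exact ContinuousAt.comp (f := fun y => z - q y)
      (contDiffAt_phi κ (sub_ne_zero_of_notMem hz y)).continuousAt
      (continuous_const.sub hq).continuousAt
  exact h1.smul hH

theorem notMem_range_of_ball {z₀ : E3} {d : ℝ} (hd : 0 < d)
    (h : ∀ z ∈ Metric.ball z₀ d, ∀ y, d ≤ ‖z - q y‖) {z : E3} (hz : z ∈ Metric.ball z₀ d) :
    z ∉ range q := by
  rintro ⟨y, rfl⟩
  have := h _ hz y
  simp at this
  linarith

theorem norm_dpot_integrand_le {z₀ : E3} {d : ℝ} (hd : 0 < d)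
    (h : ∀ z ∈ Metric.ball z₀ d, ∀ y, d ≤ ‖z - q y‖) {z : E3} (hz : z ∈ Metric.ball z₀ d)
    (y : S2) : ‖(fderiv ℝ (phi κ) (z - q y)).smulRight (H y)‖ ≤
      (|κ| * d⁻¹ + (d ^ 2)⁻¹) * ‖H y‖ := by
  refine (norm_smulRight_le _ _).trans ?_
  refine mul_le_mul_of_nonneg_right ?_ (norm_nonneg _)
  refine (norm_fderiv_phi_le κ (sub_ne_zero_of_notMem (notMem_range_of_ball hd h hz) y)).trans ?_
  have := h z hz y
  gcongr

theorem hasFDerivAt_pot (hq : Continuous q) (hH : Continuous H) {z₀ : E3} (hz₀ : z₀ ∉ range q) :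
    HasFDerivAt (pot q κ H) (dpot q κ H z₀) z₀ := by
  obtain ⟨d, hd, h⟩ := exists_ball_dist_range hq hz₀
  have hball := Metric.ball_mem_nhds z₀ hd
  refine hasFDerivAt_integral_of_dominated_of_fderiv_le
    (bound := fun y => (|κ| * d⁻¹ + (d ^ 2)⁻¹) * ‖H y‖)
    (F' := fun z y => (fderiv ℝ (phi κ) (z - q y)).smulRight (H y)) hball ?_ ?_ ?_ ?_ ?_ ?_
  · filter_upwards [hball] with z hz
    exact (continuous_pot_integrand hq hH (notMem_range_of_ball hd h hz)).aestronglyMeasurable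
  · exact Continuous.integrable_dsS2 (continuous_pot_integrand hq hH hz₀)
  · exact (continuous_dpot_integrand hq hH hz₀).aestronglyMeasurable
  · exact ae_of_all _ fun y z hz => norm_dpot_integrand_le hd h hz y
  · exact Continuous.integrable_dsS2 (by fun_prop)
  · refine ae_of_all _ fun y z hz => ?_
    have h1 := hasFDerivAt_phi κ (sub_ne_zero_of_notMem (notMem_range_of_ball hd h hz) y)
    have h2 := h1.comp z ((hasFDerivAt_id z).sub_const (q y))
    exact h2.smul_const (H y)

/-- This is the regularity that `stokes` requires of the field on a parallel surface. -/
theorem contDiffAt_pot (hq : Continuous q) (hH : Continuous H) {z₀ : E3} (hz₀ : z₀ ∉ range q) :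
    ContDiffAt ℝ 1 (pot q κ H) z₀ := by
  obtain ⟨d, hd, h⟩ := exists_ball_dist_range hq hz₀
  rw [contDiffAt_one_iff]
  refine ⟨dpot q κ H, Metric.ball z₀ d, Metric.ball_mem_nhds z₀ hd, ?_, fun z hz =>
    hasFDerivAt_pot hq hH (notMem_range_of_ball hd h hz)⟩
  refine continuousOn_of_dominated (bound := fun y => (|κ| * d⁻¹ + (d ^ 2)⁻¹) * ‖H y‖) ?_ ?_ ?_ ?_
  · exact fun z hz => (continuous_dpot_integrand hq hH
      (notMem_range_of_ball hd h hz)).aestronglyMeasurable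
  · exact fun z hz => ae_of_all _ fun y => norm_dpot_integrand_le hd h hz y
  · exact Continuous.integrable_dsS2 (by fun_prop)
  · refine ae_of_all _ fun y => continuousOn_clm_apply.mpr fun v z hz =>
      ContinuousAt.continuousWithinAt ?_
    have h1 : ContinuousAt (fun z => fderiv ℝ (phi κ) (z - q y)) z :=
      ContinuousAt.comp (f := fun z => z - q y) (continuousAt_fderiv_phi κ
        (sub_ne_zero_of_notMem (notMem_range_of_ball hd h hz) y)) (by fun_prop)
    exact (h1.clm_apply continuousAt_const).smul continuousAt_const

/-- The component of the curl along `c` as a linear functional of the derivative. -/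
noncomputable def curlFunctional (c : C3) : (E3 →L[ℝ] C3) →L[ℝ] ℂ :=
  LinearMap.toContinuousLinearMap
    { toFun := fun D => c ⬝ᵥ ![D (e3 1) 2 - D (e3 2) 1, D (e3 2) 0 - D (e3 0) 2,
        D (e3 0) 1 - D (e3 1) 0]
      map_add' := fun D D' => by
        simp [dotProduct, Fin.sum_univ_three]
        ring
      map_smul' := fun r D => by
        simp [dotProduct, Fin.sum_univ_three]
        ring }

theorem curlFunctional_fderiv (c : C3) (W : E3 → C3) (z : E3) :
    curlFunctional c (fderiv ℝ W z) = c ⬝ᵥ curl W z := rfl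

theorem curlFunctional_smulRight (c : C3) (L : E3 →L[ℝ] ℂ) (v : C3) :
    curlFunctional c (L.smulRight v) = c ⬝ᵥ ((fun j => L (e3 j)) ⨯₃ v) := by
  simp [curlFunctional, dotProduct, Fin.sum_univ_three, cross_apply]

/-- The curl of the potential off the surface. -/
theorem dotProduct_curl_pot (hq : Continuous q) (hH : Continuous H) {z : E3} (hz : z ∉ range q)
    (c : C3) : c ⬝ᵥ curl (pot q κ H) z = ∫ y, c ⬝ᵥ (gphi κ (z - q y) ⨯₃ H y) ∂dsS2 := by
  -- A component of the curl is a continuous linear functional of the derivative, so it passes under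
  -- the integral.
  rw [← curlFunctional_fderiv, (hasFDerivAt_pot hq hH hz).fderiv, dpot,
    ← ContinuousLinearMap.integral_comp_comm _
      (Continuous.integrable_dsS2 (continuous_dpot_integrand hq hH hz))]
  simp_rw [curlFunctional_smulRight]
  rfl

/-- Here the curl is taken in the source variable `w`, whence the minus sign. It makes the kernel
itself a field on `Γ` to which `stokes` applies. -/
theorem curl_kernel (z w : E3) (hzw : z ≠ w) (c : C3) :
    ContDiffAt ℝ 1 (fun w => phi κ (z - w) • c) w ∧
      ∀ b : C3, b ⬝ᵥ curl (fun w => phi κ (z - w) • c) w = -(b ⬝ᵥ (gphi κ (z - w) ⨯₃ c)) := by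
  have hne : z - w ≠ 0 := sub_ne_zero.mpr hzw
  constructor
  · have h1 : ContDiffAt ℝ 1 (fun w => phi κ (z - w)) w :=
      ContDiffAt.comp (f := fun w => z - w) w ((contDiffAt_phi κ hne).of_le (by simp))
        (contDiffAt_const.sub contDiffAt_id)
    exact h1.smul contDiffAt_const
  · intro b
    have h2 := ((hasFDerivAt_phi κ hne).comp w ((hasFDerivAt_id w).const_sub z)).smul_const c
    have h3 : fderiv ℝ (fun w => phi κ (z - w) • c) w = _ := h2.fderiv
    rw [← curlFunctional_fderiv, h3, curlFunctional_smulRight]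
    simp [gphi, dotProduct, Fin.sum_univ_three, cross_apply]
    ring

end Potential

section Surface

variable {q : S2 → E3} {κ : ℝ} {g : E3 → C3}

theorem IsParametrization.measurableEmbedding (hq : IsParametrization q) : MeasurableEmbedding q :=
  (hq.smoothExt.continuous.isClosedEmbedding hq.injective).measurableEmbedding

theorem IsParametrization.integral_surfaceMeasure (hq : IsParametrization q) {F : Type*}
    [NormedAddCommGroup F] [NormedSpace ℝ F] (f : E3 → F) :
    ∫ y, f y ∂(surfaceMeasure q) = ∫ y, jac q y • f (q y) ∂dsS2 := by
  rw [surfaceMeasure, hq.measurableEmbedding.integral_map,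
    integral_withDensity_eq_integral_toReal_smul
    hq.smoothExt_jac.continuous.measurable.ennreal_ofReal (by simp)]
  simp_rw [ENNReal.toReal_ofReal (hq.jac_pos _).le]

theorem IsParametrization.integrable_surfaceMeasure (hq : IsParametrization q) {F : Type*}
    [NormedAddCommGroup F] [NormedSpace ℝ F] (f : E3 → F) :
    Integrable f (surfaceMeasure q) ↔ Integrable (fun y => jac q y • f (q y)) dsS2 := by
  rw [surfaceMeasure, hq.measurableEmbedding.integrable_map_iff,
    integrable_withDensity_iff_integrable_smul'
      hq.smoothExt_jac.continuous.measurable.ennreal_ofReal (by simp)]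
  simp_rw [ENNReal.toReal_ofReal (hq.jac_pos _).le]
  rfl

/-- The density `J_q (g ∘ q)` on the sphere. -/
noncomputable def dens (q : S2 → E3) (g : E3 → C3) (y : S2) : C3 := jac q y • g (q y)

theorem IsParametrization.vecPotential_eq (hq : IsParametrization q) :
    vecPotential q κ g = pot q κ (dens q g) := by
  ext1 z
  rw [vecPotential, hq.integral_surfaceMeasure, pot]
  congr 1 with y : 1
  rw [Phi_eq, dens, smul_comm]

theorem IsParametrization.continuous_comp (hq : IsParametrization q)
    (hg : ContinuousOn g (range q)) : Continuous fun y => g (q y) :=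
  hg.comp_continuous hq.smoothExt.continuous mem_range_self

theorem IsParametrization.continuous_dens (hq : IsParametrization q)
    (hg : ContinuousOn g (range q)) : Continuous (dens q g) :=
  hq.smoothExt_jac.continuous.smul (hq.continuous_comp hg)

theorem IsParametrization.integrable_Phi (hq : IsParametrization q)
    (hg : ContinuousOn g (range q)) {z : E3} (hz : z ∉ range q) :
    Integrable (fun y => Phi κ z y • g y) (surfaceMeasure q) := by
  rw [hq.integrable_surfaceMeasure]
  refine Continuous.integrable_dsS2 ?_
  have := continuous_pot_integrand (κ := κ) hq.smoothExt.continuous (hq.continuous_dens hg) hz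
  refine this.congr fun y => ?_
  rw [Phi_eq, dens, smul_comm]

end Surface

end SphereBIE

/-! ### Limits along the normals and the existence of `Ng` for Hölder densities. -/

namespace SphereBIE

variable {q : S2 → E3} {κ : ℝ} {g : E3 → C3}

/-- The point at signed distance `h` from the surface along the normal. -/
noncomputable def shift (q : S2 → E3) (h : ℝ) (x : S2) : E3 := q x + h • nuS q x

@[simp] theorem shift_zero (q : S2 → E3) (x : S2) : shift q 0 x = q x := by simp [shift]

/-- The distance from the points of parallel surfaces to the surface is bounded below. -/
structure DistBound (q : S2 → E3) (c δ : ℝ) : Prop where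
  c_pos : 0 < c
  δ_pos : 0 < δ
  le_dist : ∀ (h : ℝ) (x y : S2), |h| ≤ δ → c * ‖(x : E3) - y‖ ≤ ‖shift q h x - q y‖
  le_abs : ∀ (h : ℝ) (x y : S2), |h| ≤ δ → c * |h| ≤ ‖shift q h x - q y‖

theorem IsParametrization.exists_distBound (hq : IsParametrization q) :
    ∃ c δ, DistBound q c δ := by
  obtain ⟨c, δ, hc, hδ, h⟩ := hq.exists_dist_bound
  exact ⟨c, δ, hc, hδ, fun t x y ht => (h t x y ht).1, fun t x y ht => (h t x y ht).2⟩

theorem S2.norm_sub_pos {x y : S2} (h : x ≠ y) : 0 < ‖(x : E3) - y‖ := by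
  rw [norm_pos_iff, sub_ne_zero]
  exact fun h' => h (Subtype.ext h')

theorem S2.norm_sub_le_two (x y : S2) : ‖(x : E3) - y‖ ≤ 2 := by
  refine (norm_sub_le _ _).trans ?_
  rw [S2.norm_coe, S2.norm_coe]
  norm_num

namespace DistBound

variable {c δ : ℝ}

theorem notMem (hb : DistBound q c δ) {h : ℝ} (h0 : h ≠ 0) (hδ : |h| ≤ δ) (x : S2) :
    shift q h x ∉ range q := by
  rintro ⟨y, hy⟩
  have := hb.le_abs h x y hδ
  rw [hy, sub_self, norm_zero] at this
  have := mul_pos hb.c_pos (abs_pos.mpr h0)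
  linarith

theorem sub_ne_zero (hb : DistBound q c δ) {h : ℝ} (hδ : |h| ≤ δ) {x y : S2} (hxy : x ≠ y) :
    shift q h x - q y ≠ 0 := by
  rw [← norm_pos_iff]
  exact (mul_pos hb.c_pos (S2.norm_sub_pos hxy)).trans_le (hb.le_dist h x y hδ)

/-- The bound is uniform in `h`. The weaker singularity `|κ| / r` is absorbed into the quadratic one
because chords of the sphere have length at most `2`. -/
theorem norm_gphi_le (hb : DistBound q c δ) {h : ℝ} (hδ : |h| ≤ δ) {x y : S2} (hxy : x ≠ y) :
    ‖gphi κ (shift q h x - q y)‖ ≤ (2 * |κ| / c + 1 / c ^ 2) * ‖(x : E3) - y‖ ^ (-2 : ℝ) := by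
  have hc := hb.c_pos
  have hd := S2.norm_sub_pos hxy
  have hd2 := S2.norm_sub_le_two x y
  have hle := hb.le_dist h x y hδ
  refine (SphereBIE.norm_gphi_le κ (hb.sub_ne_zero hδ hxy)).trans ?_
  rw [Real.rpow_neg hd.le, Real.rpow_ofNat]
  generalize ‖(x : E3) - y‖ = d at *
  have h1 : |κ| * ‖shift q h x - q y‖⁻¹ ≤ 2 * |κ| / c * (d ^ 2)⁻¹ := by
    calc |κ| * ‖shift q h x - q y‖⁻¹ ≤ |κ| * (c * d)⁻¹ := by gcongr
      _ = |κ| / c * (d ^ 2)⁻¹ * d := by field_simp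
      _ ≤ |κ| / c * (d ^ 2)⁻¹ * 2 := by gcongr
      _ = _ := by ring
  have h2 : (‖shift q h x - q y‖ ^ 2)⁻¹ ≤ 1 / c ^ 2 * (d ^ 2)⁻¹ := by
    calc (‖shift q h x - q y‖ ^ 2)⁻¹ ≤ ((c * d) ^ 2)⁻¹ := by gcongr
      _ = _ := by field_simp
  linarith

end DistBound

theorem IsParametrization.continuous_shift (hq : IsParametrization q) :
    Continuous fun z : ℝ × S2 => shift q z.1 z.2 := by
  have h1 := hq.smoothExt.continuous
  have h2 := hq.smoothExt_nuS.continuous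
  unfold shift
  fun_prop

theorem continuousAt_shift_sub (hq : IsParametrization q) {δ : ℝ}
    (z : (Icc (-δ) δ × S2) × S2) :
    ContinuousAt (fun z : (Icc (-δ) δ × S2) × S2 => shift q z.1.1 z.1.2 - q z.2) z := by
  have h1 := hq.smoothExt.continuous
  have h2 := hq.continuous_shift
  have h3 : Continuous fun z : (Icc (-δ) δ × S2) × S2 => shift q z.1.1 z.1.2 :=
    h2.comp (by fun_prop : Continuous fun z : (Icc (-δ) δ × S2) × S2 => ((z.1.1 : ℝ), z.1.2))
  exact (h3.sub (h1.comp continuous_snd)).continuousAt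

theorem exists_norm_bound {F : Type*} [NormedAddCommGroup F] {f : S2 → F} (hf : Continuous f) :
    ∃ C : ℝ, 0 ≤ C ∧ ∀ x, ‖f x‖ ≤ C := by
  obtain ⟨C, hC⟩ := (isCompact_range hf).isBounded.exists_norm_le
  exact ⟨max C 0, le_max_right _ _, fun x => (hC _ (mem_range_self x)).trans (le_max_left _ _)⟩

/-- The potential is continuous up to and across the surface along the normals. -/
theorem IsParametrization.continuous_pot_shift (hq : IsParametrization q) {c δ : ℝ}
    (hb : DistBound q c δ) {H : S2 → C3} (hH : Continuous H) :
    (∀ t : Icc (-δ) δ × S2,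
      Integrable (fun y => phi κ (shift q t.1 t.2 - q y) • H y) dsS2) ∧
    Continuous fun t : Icc (-δ) δ × S2 => pot q κ H (shift q t.1 t.2) := by
  obtain ⟨C, hC, hHC⟩ := exists_norm_bound hH
  have hc := hb.c_pos
  refine weaklySingular (T := Icc (-δ) δ × S2) (π := Prod.snd) continuous_snd
    (K := fun t y => phi κ (shift q t.1 t.2 - q y) • H y) (p := 1) ?_ one_pos (by norm_num)
    (C := c⁻¹ * C) (by positivity) ?_
  · rintro ⟨⟨h, hh⟩, x⟩ y hxy
    have h1 := continuousAt_shift_sub hq (δ := δ) ((⟨h, hh⟩, x), y)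
    have h2 : ContinuousAt (fun z : (Icc (-δ) δ × S2) × S2 =>
        phi κ (shift q z.1.1 z.1.2 - q z.2)) ((⟨h, hh⟩, x), y) :=
      ContinuousAt.comp (g := phi κ)
        (f := fun z : (Icc (-δ) δ × S2) × S2 => shift q z.1.1 z.1.2 - q z.2) (contDiffAt_phi κ (hb.sub_ne_zero (abs_le.mpr hh) hxy)).continuousAt h1
    exact h2.smul (hH.comp continuous_snd).continuousAt
  · rintro ⟨⟨h, hh⟩, x⟩ y hxy
    have hd := S2.norm_sub_pos hxy
    have hle := hb.le_dist h x y (abs_le.mpr hh)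
    rw [norm_smul, Real.rpow_neg_one]
    calc ‖phi κ (shift q h x - q y)‖ * ‖H y‖ ≤ (c * ‖(x : E3) - y‖)⁻¹ * C := by
          refine mul_le_mul ((norm_phi_le κ _).trans ?_) (hHC y) (norm_nonneg _) (by positivity)
          gcongr
      _ = c⁻¹ * C * ‖(x : E3) - y‖⁻¹ := by rw [mul_inv]; ring

theorem curlS2_one : curlS2 (fun _ => 1) = 0 := by
  have h : gradS2 (fun _ : S2 => (1 : ℂ)) = 0 := by
    ext x i
    have h1 : radialExt (fun _ : S2 => (1 : ℂ)) =ᶠ[𝓝 (x : E3)] fun _ => 1 := by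
      filter_upwards [isOpen_compl_singleton.mem_nhds (S2.coe_ne_zero x)] with z hz
      exact radialExt_of_ne _ hz
    simp [gradS2, h1.fderiv_eq]
  ext x i
  simp [curlS2, h]

/-- The flux of the curl of a constant vector times the fundamental solution vanishes. -/
theorem IsParametrization.integral_flux_kernel (hq : IsParametrization q) {z : E3}
    (hz : z ∉ range q) (b : C3) :
    ∫ y, cvec (areaVec q y) ⬝ᵥ (gphi κ (z - q y) ⨯₃ b) ∂dsS2 = 0 := by
  have hk := fun x : S2 => curl_kernel (κ := κ) z (q x) (fun h => hz ⟨x, h.symm⟩) b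
  -- The constant test function has zero surface curl, and the field is smooth on `Γ` because `z`
  -- lies off it.
  have h1 := stokes hq.smoothExt (fun x => (hk x).1) (smoothExt_const (1 : ℂ))
  have h2 : ∀ x, DcurlS2 q (fun _ => 1) x = 0 := fun x => by simp [DcurlS2, curlS2_one]
  simp only [(hk _).2, mul_one, h2, dotProduct_zero, integral_zero, integral_neg, neg_eq_zero]
    at h1
  exact h1

theorem continuousAt_triple {X : Type*} [TopologicalSpace X] {u v w : X → C3} {x : X}
    (hu : ContinuousAt u x) (hv : ContinuousAt v x) (hw : ContinuousAt w x) :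
    ContinuousAt (fun x => u x ⬝ᵥ (v x ⨯₃ w x)) x := by
  have h : Continuous fun z : C3 × C3 × C3 => z.1 ⬝ᵥ (z.2.1 ⨯₃ z.2.2) := by
    simp only [dotProduct, Fin.sum_univ_three, cross_apply, Matrix.cons_val_zero,
      Matrix.cons_val_one, Matrix.cons_val]
    fun_prop
  exact ContinuousAt.comp (f := fun x => (u x, v x, w x)) h.continuousAt
    (hu.prodMk (hv.prodMk hw))

/-- The regularized kernel of the normal component of the curl of the potential. -/
noncomputable def normalKernel (q : S2 → E3) (κ : ℝ) (g : E3 → C3) (h : ℝ) (x y : S2) : ℂ :=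
  2 * (cvec (nuS q x) ⬝ᵥ (gphi κ (shift q h x - q y) ⨯₃ dens q g y) -
    cvec (areaVec q y) ⬝ᵥ (gphi κ (shift q h x - q y) ⨯₃ g (q x)))

theorem IsParametrization.NOff_apply (hq : IsParametrization q) (h : ℝ) (x : S2) :
    NOff q κ g h (q x) =
      2 * (cvec (nuS q x) ⬝ᵥ curl (pot q κ (dens q g)) (shift q h x)) := by
  rw [NOff, hq.normal_apply, hq.vecPotential_eq]
  rfl

theorem continuous_gphi_sub (hq : Continuous q) {z : E3} (hz : z ∉ range q) :
    Continuous fun y => gphi κ (z - q y) :=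
  continuous_iff_continuousAt.mpr fun y =>
    ContinuousAt.comp (f := fun y => z - q y) (continuousAt_gphi κ (sub_ne_zero_of_notMem hz y))
      (continuous_const.sub hq).continuousAt

/-- The term subtracted in `normalKernel` has the density frozen at the foot point `q x`. It
integrates to zero by `integral_flux_kernel`. -/
theorem IsParametrization.NOff_eq_integral (hq : IsParametrization q)
    (hg : ContinuousOn g (range q)) {h : ℝ} {x : S2} (hx : shift q h x ∉ range q) :
    NOff q κ g h (q x) = ∫ y, normalKernel q κ g h x y ∂dsS2 := by
  have hqc := hq.smoothExt.continuous
  have hgc := continuous_gphi_sub (κ := κ) hqc hx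
  simp only [normalKernel]
  rw [hq.NOff_apply, dotProduct_curl_pot hqc (hq.continuous_dens hg) hx, integral_const_mul,
    integral_sub, hq.integral_flux_kernel hx, sub_zero]
  · exact Continuous.integrable_dsS2 (continuous_iff_continuousAt.mpr fun y =>
      continuousAt_triple continuousAt_const hgc.continuousAt (hq.continuous_dens hg).continuousAt)
  · exact Continuous.integrable_dsS2 (continuous_iff_continuousAt.mpr fun y =>
      continuousAt_triple (continuous_cvec.comp hq.smoothExt.areaVec.continuous).continuousAt
        hgc.continuousAt continuousAt_const)

/-- With `r = J_q(ŷ)`, `u = ν(x)`, `u' = ν(y)`, `w = g(y)`, `w' = g(x)`, the regularized kernel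
splits into an increment of the density and an increment of the normal. -/
theorem triple_sub (u u' v w w' : C3) (r : ℝ) :
    u ⬝ᵥ (v ⨯₃ (r • w)) - ((r : ℂ) • u') ⬝ᵥ (v ⨯₃ w') =
      r * (u ⬝ᵥ (v ⨯₃ (w - w')) + (u - u') ⬝ᵥ (v ⨯₃ w')) := by
  simp [dotProduct, Fin.sum_univ_three, cross_apply]
  ring

/-- In both terms of `triple_sub` the gradient, of order `|x̂ - ŷ|^(-2)`, meets an increment of
order `|x̂ - ŷ|^α`: the density is Hölder and the normal is Lipschitz. -/
theorem IsParametrization.exists_normalKernel_bound (hq : IsParametrization q)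
    (hg : ContinuousOn g (range q)) {c δ : ℝ} (hb : DistBound q c δ) {A α : NNReal}
    (hα : α ≤ 1) (hH : HolderOnWith A α g (range q)) :
    ∃ C : ℝ, 0 ≤ C ∧ ∀ (h : ℝ) (x y : S2), |h| ≤ δ → x ≠ y →
      ‖normalKernel q κ g h x y‖ ≤ C * ‖(x : E3) - y‖ ^ (-(2 - α : ℝ)) := by
  obtain ⟨L, hL, hqL⟩ := hq.smoothExt.exists_lipschitz
  obtain ⟨L', hL', hnL⟩ := hq.smoothExt_nuS.exists_lipschitz
  obtain ⟨MJ, hMJ, hJ⟩ := exists_norm_bound hq.smoothExt_jac.continuous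
  obtain ⟨MG, hMG, hG⟩ := exists_norm_bound (hq.continuous_comp hg)
  have hc := hb.c_pos
  have hα' : (α : ℝ) ≤ 1 := by exact_mod_cast hα
  refine ⟨2 * (MJ * (6 * ((2 * |κ| / c + 1 / c ^ 2) * (A * L ^ (α : ℝ))) +
    6 * (2 * L' * (2 * |κ| / c + 1 / c ^ 2) * MG))), by positivity, fun h x y hδ hxy => ?_⟩
  have hd := S2.norm_sub_pos hxy
  have hd2 := S2.norm_sub_le_two x y
  have h1 := hb.norm_gphi_le (κ := κ) hδ hxy
  have h2 : ‖g (q y) - g (q x)‖ ≤ A * L ^ (α : ℝ) * ‖(x : E3) - y‖ ^ (α : ℝ) := by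
    have h3 := hH.dist_le (mem_range_self y) (mem_range_self x)
    rw [dist_eq_norm, dist_eq_norm] at h3
    refine h3.trans ?_
    rw [mul_assoc, ← Real.mul_rpow hL hd.le, norm_sub_rev (q y)]
    gcongr
    exact hqL x y
  have h4 : ‖cvec (nuS q x) - cvec (nuS q y)‖ ≤ 2 * L' * ‖(x : E3) - y‖ ^ (α : ℝ) := by
    rw [← cvec_sub]
    refine (norm_cvec_le _).trans ((hnL x y).trans ?_)
    -- Lipschitz is weakened to Hölder: for a chord `d ≤ 2`, `d^(1 - α) ≤ 2^(1 - α) ≤ 2`.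
    have h5 : ‖(x : E3) - y‖ ≤ 2 * ‖(x : E3) - y‖ ^ (α : ℝ) := by
      have h6 : ‖(x : E3) - y‖ = ‖(x : E3) - y‖ ^ (1 - α : ℝ) * ‖(x : E3) - y‖ ^ (α : ℝ) := by
        rw [← Real.rpow_add hd]; simp
      have h7 : ‖(x : E3) - y‖ ^ (1 - α : ℝ) ≤ 2 := by
        calc ‖(x : E3) - y‖ ^ (1 - α : ℝ) ≤ 2 ^ (1 - α : ℝ) := by gcongr
          _ ≤ 2 ^ (1 : ℝ) := by
              apply Real.rpow_le_rpow_of_exponent_le (by norm_num)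
              have : (0 : ℝ) ≤ α := α.2
              linarith
          _ = 2 := by simp
      calc ‖(x : E3) - y‖ = _ := h6
        _ ≤ _ := by gcongr
    calc L' * ‖(x : E3) - y‖ ≤ L' * (2 * ‖(x : E3) - y‖ ^ (α : ℝ)) := by gcongr
      _ = _ := by ring
  have e1 : ‖(x : E3) - y‖ ^ (-(2 - α : ℝ)) =
      ‖(x : E3) - y‖ ^ (-2 : ℝ) * ‖(x : E3) - y‖ ^ (α : ℝ) := by
    rw [← Real.rpow_add hd]; congr 1; ring
  have h8 : ‖cvec (nuS q x) ⬝ᵥ (gphi κ (shift q h x - q y) ⨯₃ (g (q y) - g (q x)))‖ ≤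
      6 * (1 * ((2 * |κ| / c + 1 / c ^ 2) * ‖(x : E3) - y‖ ^ (-2 : ℝ)) *
        (A * L ^ (α : ℝ) * ‖(x : E3) - y‖ ^ (α : ℝ))) := by
    refine (norm_triple_le _ _ _).trans ?_
    have h9 : ‖cvec (nuS q x)‖ ≤ 1 := (norm_cvec_le _).trans (hq.norm_nuS x).le
    gcongr
  have h10 : ‖(cvec (nuS q x) - cvec (nuS q y)) ⬝ᵥ (gphi κ (shift q h x - q y) ⨯₃ g (q x))‖ ≤
      6 * (2 * L' * ‖(x : E3) - y‖ ^ (α : ℝ) *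
        ((2 * |κ| / c + 1 / c ^ 2) * ‖(x : E3) - y‖ ^ (-2 : ℝ)) * MG) := by
    refine (norm_triple_le _ _ _).trans ?_
    have h9 := hG x
    gcongr
  rw [normalKernel, dens, hq.areaVec_eq y, cvec_smul, triple_sub, norm_mul, norm_mul,
    Complex.norm_ofNat, Complex.norm_real]
  have h11 := hJ y
  calc _ ≤ 2 * (MJ * (6 * (1 * ((2 * |κ| / c + 1 / c ^ 2) * ‖(x : E3) - y‖ ^ (-2 : ℝ)) *
        (A * L ^ (α : ℝ) * ‖(x : E3) - y‖ ^ (α : ℝ))) + 6 * (2 * L' * ‖(x : E3) - y‖ ^ (α : ℝ) *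
        ((2 * |κ| / c + 1 / c ^ 2) * ‖(x : E3) - y‖ ^ (-2 : ℝ)) * MG))) := by
        gcongr
        exact (norm_add_le _ _).trans (add_le_add h8 h10)
    _ = _ := by rw [e1]; ring

/-- A function of the distance to the surface and the foot point that extends continuously to
the surface has uniform normal limits. -/
theorem tendstoUniformlyOn_NOff {δ : ℝ} (hδ : 0 < δ) {F : Icc (-δ) δ × S2 → ℂ} (hF : Continuous F)
    (hN : ∀ (h : ℝ) (hh : h ∈ Icc (-δ) δ) (x : S2), h ≠ 0 → NOff q κ g h (q x) = F (⟨h, hh⟩, x)) :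
    NExists q κ g := by
  -- Compactness of `[-δ, δ] × 𝕊²` makes the limit uniform in the foot point; `F` at `h = 0` is its
  -- value.
  have hu := CompactSpace.uniformContinuous_of_continuous hF
  have h0 : (0 : ℝ) ∈ Icc (-δ) δ := ⟨by linarith, hδ.le⟩
  have key : ∀ ε > 0, ∀ᶠ h in 𝓝[≠] (0 : ℝ), ∀ x : S2,
      dist (F (⟨0, h0⟩, x)) (NOff q κ g h (q x)) < ε := by
    intro ε hε
    obtain ⟨η, hη, hu⟩ := Metric.uniformContinuous_iff.mp hu ε hε
    have h1 : ∀ᶠ h in 𝓝[≠] (0 : ℝ), h ∈ Metric.ball (0 : ℝ) (min η δ) :=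
      nhdsWithin_le_nhds (Metric.ball_mem_nhds _ (lt_min hη hδ))
    filter_upwards [h1, self_mem_nhdsWithin] with h hh hne x
    rw [mem_ball_zero_iff, Real.norm_eq_abs, lt_min_iff] at hh
    have hm : h ∈ Icc (-δ) δ := abs_le.mp hh.2.le
    rw [hN h hm x hne]
    refine hu ?_
    rw [Prod.dist_eq, dist_self, max_eq_left dist_nonneg, Subtype.dist_eq, Real.dist_eq]
    simpa using hh.1
  have hlim : ∀ x, N q κ g (q x) = F (⟨0, h0⟩, x) := by
    intro x
    refine Tendsto.limUnder_eq ?_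
    rw [Metric.tendsto_nhds]
    intro ε hε
    filter_upwards [key ε hε] with h hh
    rw [dist_comm]
    exact hh x
  rw [NExists, Metric.tendstoUniformlyOn_iff]
  intro ε hε
  filter_upwards [key ε hε] with h hh
  rintro _ ⟨x, rfl⟩
  rw [hlim]
  exact hh x

theorem IsParametrization.nExists_of_holder (hq : IsParametrization q)
    (hg : ContinuousOn g (range q)) {A α : NNReal} (hα0 : 0 < α) (hα : α ≤ 1)
    (hH : HolderOnWith A α g (range q)) : NExists q κ g := by
  obtain ⟨c, δ, hb⟩ := hq.exists_distBound
  obtain ⟨C, hC, hK⟩ := hq.exists_normalKernel_bound (κ := κ) hg hb hα hH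
  have hα' : (α : ℝ) ≤ 1 := by exact_mod_cast hα
  have hα0' : (0 : ℝ) < α := by exact_mod_cast hα0
  have hF := (weaklySingular (T := Icc (-δ) δ × S2) (π := Prod.snd) continuous_snd
    (K := fun t y => normalKernel q κ g t.1 t.2 y) (p := 2 - α) ?_ (by linarith) (by linarith)
    hC fun t y hxy => hK _ _ _ (abs_le.mpr t.1.2) hxy).2
  · exact tendstoUniformlyOn_NOff hb.δ_pos hF fun h hh x h0 =>
      hq.NOff_eq_integral hg (hb.notMem h0 (abs_le.mpr hh) x)
  · rintro ⟨⟨h, hh⟩, x⟩ y hxy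
    have h1 := continuousAt_shift_sub hq (δ := δ) ((⟨h, hh⟩, x), y)
    have h2 : ContinuousAt (fun z : (Icc (-δ) δ × S2) × S2 =>
        gphi κ (shift q z.1.1 z.1.2 - q z.2)) ((⟨h, hh⟩, x), y) :=
      ContinuousAt.comp (g := gphi κ)
        (f := fun z : (Icc (-δ) δ × S2) × S2 => shift q z.1.1 z.1.2 - q z.2)
        (continuousAt_gphi κ (hb.sub_ne_zero (abs_le.mpr hh) hxy)) h1
    have c1 : Continuous fun z : (Icc (-δ) δ × S2) × S2 => cvec (nuS q z.1.2) :=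
      (continuous_cvec.comp hq.smoothExt_nuS.continuous).comp (by fun_prop)
    have c2 : Continuous fun z : (Icc (-δ) δ × S2) × S2 => dens q g z.2 :=
      (hq.continuous_dens hg).comp (by fun_prop)
    have c3 : Continuous fun z : (Icc (-δ) δ × S2) × S2 => cvec (areaVec q z.2) :=
      (continuous_cvec.comp hq.smoothExt.areaVec.continuous).comp (by fun_prop)
    have c4 : Continuous fun z : (Icc (-δ) δ × S2) × S2 => g (q z.1.2) :=
      (hq.continuous_comp hg).comp (by fun_prop)
    exact ((continuousAt_triple c1.continuousAt h2 c2.continuousAt).sub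
      (continuousAt_triple c3.continuousAt h2 c4.continuousAt)).const_mul 2

end SphereBIE

/-! ### The weak identity as a limit of Stokes' theorem on parallel surfaces. -/

namespace SphereBIE

variable {q : S2 → E3} {κ : ℝ} {g : E3 → C3}

section SingleLayer

/-- The chord `|x̂ - ŷ|` cancels against `R`, and the cosine and sine parts recombine into the
exponential. The diagonal is a null set for each fixed `x̂`. -/
theorem singleLayerKernel_smul (hq : IsParametrization q) {x y : S2} (hxy : x ≠ y) :
    singleLayerKernel q κ x y • g (q y) = (2 : ℂ) • (phi κ (q x - q y) • dens q g y) := by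
  have h1 : (‖(x : E3) - y‖ : ℂ) ≠ 0 := by exact_mod_cast (S2.norm_sub_pos hxy).ne'
  have hne : q x ≠ q y := fun h => hxy (hq.injective h)
  have h2 : (‖q x - q y‖ : ℂ) ≠ 0 := by
    exact_mod_cast norm_ne_zero_iff.mpr (sub_ne_zero.mpr hne)
  have h3 : (Real.pi : ℂ) ≠ 0 := by exact_mod_cast Real.pi_ne_zero
  have hexp : Complex.exp (Complex.I * κ * (‖q x - q y‖ : ℂ)) =
      Complex.cos (κ * (‖q x - q y‖ : ℂ)) + Complex.sin (κ * (‖q x - q y‖ : ℂ)) * Complex.I := by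
    rw [← Complex.exp_mul_I]
    congr 1
    ring
  have key : singleLayerKernel q κ x y = 2 * (phi κ (q x - q y) * (jac q y : ℂ)) := by
    rw [← Phi_eq, Phi, hexp, singleLayerKernel, s1, s2, if_neg hne, R]
    push_cast
    field_simp
    ring
  rw [key, dens, ← smul_smul, ← smul_smul]
  rfl

theorem singleLayer_eq (hq : IsParametrization q) (x : S2) :
    singleLayer q κ (g ∘ q) x = (2 : ℂ) • pot q κ (dens q g) (q x) := by
  rw [singleLayer, pot, ← integral_smul]
  refine integral_congr_ae ?_
  filter_upwards [ae_ne_dsS2 x] with y hy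
  exact singleLayerKernel_smul hq hy.symm

theorem integrable_singleLayerKernel (hq : IsParametrization q) (hg : ContinuousOn g (range q))
    (x : S2) : Integrable (fun y => singleLayerKernel q κ x y • g (q y)) dsS2 := by
  obtain ⟨c, δ, hb⟩ := hq.exists_distBound
  have h1 := (hq.continuous_pot_shift (κ := κ) hb (hq.continuous_dens hg)).1
    (⟨0, by constructor <;> linarith [hb.δ_pos]⟩, x)
  simp only [shift_zero] at h1
  refine (h1.smul (2 : ℂ)).congr ?_
  filter_upwards [ae_ne_dsS2 x] with y hy
  exact (singleLayerKernel_smul hq hy.symm).symm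

end SingleLayer

section Shift

theorem radialExt_shift (q : S2 → E3) (h : ℝ) :
    radialExt (shift q h) = fun w => radialExt q w + h • radialExt (nuS q) w := by
  ext1 w
  by_cases hw : w = 0
  · simp [radialExt, hw]
  · simp only [radialExt_of_ne _ hw, shift]

theorem IsParametrization.smoothExt_shift (hq : IsParametrization q) (h : ℝ) :
    SmoothExt (shift q h) :=
  hq.smoothExt.add (hq.smoothExt_nuS.const_smul h)

theorem IsParametrization.DS2_shift (hq : IsParametrization q) (h : ℝ) (x : S2) :
    DS2 (shift q h) x = DS2 q x + h • DS2 (nuS q) x := by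
  have hx := S2.coe_ne_zero x
  have h1 := ((hq.smoothExt x hx).differentiableAt (by simp)).hasFDerivAt
  have h2 := ((hq.smoothExt_nuS x hx).differentiableAt (by simp)).hasFDerivAt
  have h3 := (h1.fun_add (h2.fun_const_smul h)).fderiv
  ext i j
  simp [DS2, radialExt_shift, h3]

/-- The cofactor vector that is bilinear in two matrices. -/
noncomputable def mixedArea (q : S2 → E3) (x : S2) : E3 :=
  WithLp.toLp 2 (((DS2 q x + DS2 (nuS q) x).adjugate - (DS2 q x).adjugate -
    (DS2 (nuS q) x).adjugate)ᵀ *ᵥ (x : E3).ofLp)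

/-- The adjugate of a `3 × 3` matrix is quadratic in its entries, so the expansion in `h` is exact.
-/
theorem IsParametrization.areaVec_shift (hq : IsParametrization q) (h : ℝ) (x : S2) :
    areaVec (shift q h) x = areaVec q x + h • (mixedArea q x + h • areaVec (nuS q) x) := by
  rw [areaVec, areaVec, areaVec, mixedArea, hq.DS2_shift]
  generalize DS2 q x = M
  generalize DS2 (nuS q) x = M'
  ext i
  fin_cases i <;>
    simp [Matrix.adjugate_fin_three, Matrix.mulVec, dotProduct, Fin.sum_univ_three] <;> ring

/-- The case `h = 1` of `areaVec_shift` expresses the mixed term through area vectors of smooth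
maps; `shift q 1` need not be an immersion. -/
theorem IsParametrization.continuous_mixedArea (hq : IsParametrization q) :
    Continuous (mixedArea q) := by
  have h : ∀ x, mixedArea q x = areaVec (shift q 1) x - areaVec q x - areaVec (nuS q) x := by
    intro x
    rw [hq.areaVec_shift]
    simp only [one_smul]
    abel
  have h' : mixedArea q = fun x =>
      areaVec (shift q 1) x - areaVec q x - areaVec (nuS q) x := funext h
  rw [h']
  exact ((hq.smoothExt_shift 1).areaVec.continuous.sub hq.smoothExt.areaVec.continuous).sub
    hq.smoothExt_nuS.areaVec.continuous

theorem IsParametrization.DcurlS2_shift (hq : IsParametrization q) (h : ℝ) (ψ : S2 → ℂ) (x : S2) :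
    DcurlS2 (shift q h) ψ x = DcurlS2 q ψ x + (h : ℂ) • DcurlS2 (nuS q) ψ x := by
  rw [DcurlS2, DcurlS2, DcurlS2, hq.DS2_shift]
  ext i
  simp only [Matrix.mulVec, dotProduct, Fin.sum_univ_three, Matrix.map_apply, Matrix.add_apply,
    Matrix.smul_apply, Pi.add_apply, Pi.smul_apply, smul_eq_mul]
  push_cast
  ring

end Shift

section Limit

/-- The contribution to the flux of the curl through the parallel surface that comes from the
deviation of its area vector from that of the surface. -/
noncomputable def deviation (q : S2 → E3) (κ : ℝ) (g : E3 → C3) (h : ℝ) (x : S2) : ℂ :=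
  ∫ y, (h : ℂ) * (cvec (mixedArea q x + h • areaVec (nuS q) x) ⬝ᵥ
    (gphi κ (shift q h x - q y) ⨯₃ dens q g y)) ∂dsS2

@[simp] theorem deviation_zero (q : S2 → E3) (κ : ℝ) (g : E3 → C3) (x : S2) :
    deviation q κ g 0 x = 0 := by
  simp [deviation]

/-- Since `c |h| ≤ r`, where `r` is the distance of the two points, `|h| |∇Φ|` is at most of order
`1 / r`. The prefactor `h` thus makes the kernel weakly singular, uniformly up to `h = 0`, without
any Hölder condition. -/
theorem IsParametrization.continuous_deviation (hq : IsParametrization q)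
    (hg : ContinuousOn g (range q)) {c δ : ℝ} (hb : DistBound q c δ) :
    Continuous fun t : Icc (-δ) δ × S2 => deviation q κ g t.1 t.2 := by
  obtain ⟨C, hC, hHC⟩ := exists_norm_bound (hq.continuous_dens hg)
  obtain ⟨C₁, hC₁, h₁⟩ := exists_norm_bound hq.continuous_mixedArea
  obtain ⟨C₂, hC₂, h₂⟩ := exists_norm_bound hq.smoothExt_nuS.areaVec.continuous
  have hc := hb.c_pos
  have hδ := hb.δ_pos
  refine (weaklySingular (T := Icc (-δ) δ × S2) (π := Prod.snd) continuous_snd (p := 1)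
    (K := fun t y => ((t.1 : ℝ) : ℂ) * (cvec (mixedArea q t.2 + (t.1 : ℝ) • areaVec (nuS q) t.2) ⬝ᵥ
      (gphi κ (shift q t.1 t.2 - q y) ⨯₃ dens q g y))) ?_ one_pos (by norm_num)
    (C := 6 * ((C₁ + δ * C₂) * ((2 * |κ| + 1 / c) / c) * C)) (by positivity) ?_).2
  · rintro ⟨⟨h, hh⟩, x⟩ y hxy
    have h1 := continuousAt_shift_sub hq (δ := δ) ((⟨h, hh⟩, x), y)
    have h2 : ContinuousAt (fun z : (Icc (-δ) δ × S2) × S2 =>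
        gphi κ (shift q z.1.1 z.1.2 - q z.2)) ((⟨h, hh⟩, x), y) :=
      ContinuousAt.comp (g := gphi κ)
        (f := fun z : (Icc (-δ) δ × S2) × S2 => shift q z.1.1 z.1.2 - q z.2)
        (continuousAt_gphi κ (hb.sub_ne_zero (abs_le.mpr hh) hxy)) h1
    have c1 : Continuous fun z : (Icc (-δ) δ × S2) × S2 =>
        cvec (mixedArea q z.1.2 + (z.1.1 : ℝ) • areaVec (nuS q) z.1.2) := by
      have d1 := hq.continuous_mixedArea
      have d2 := hq.smoothExt_nuS.areaVec.continuous
      exact continuous_cvec.comp (by fun_prop)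
    have c2 : Continuous fun z : (Icc (-δ) δ × S2) × S2 => dens q g z.2 :=
      (hq.continuous_dens hg).comp (by fun_prop)
    have c3 : Continuous fun z : (Icc (-δ) δ × S2) × S2 => ((z.1.1 : ℝ) : ℂ) := by fun_prop
    exact c3.continuousAt.mul (continuousAt_triple c1.continuousAt h2 c2.continuousAt)
  · rintro ⟨⟨h, hh⟩, x⟩ y hxy
    have hd := S2.norm_sub_pos hxy
    have hd2 := S2.norm_sub_le_two x y
    have hle := hb.le_dist h x y (abs_le.mpr hh)
    have hle' := hb.le_abs h x y (abs_le.mpr hh)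
    have hr := norm_pos_iff.mpr (hb.sub_ne_zero (abs_le.mpr hh) hxy)
    have hhδ : |h| ≤ δ := abs_le.mpr hh
    dsimp only at hd hd2 hle hle' hr ⊢
    have e1 : |h| * ‖gphi κ (shift q h x - q y)‖ ≤
        (2 * |κ| + 1 / c) / c * ‖(x : E3) - y‖⁻¹ := by
      have f1 := norm_gphi_le κ (norm_pos_iff.mp hr)
      generalize ‖shift q h x - q y‖ = r at *
      generalize ‖(x : E3) - y‖ = d at *
      -- This is where one power of the singularity is traded for `h`.
      have f2 : |h| ≤ r / c := by rw [le_div_iff₀ hc]; linarith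
      calc |h| * ‖gphi κ (shift q h x - q y)‖ ≤ r / c * (|κ| * r⁻¹ + (r ^ 2)⁻¹) := by gcongr
        _ = (|κ| + r⁻¹) / c := by field_simp
        _ ≤ (2 * |κ| * d⁻¹ + (c * d)⁻¹) / c := by
            have f3 : |κ| ≤ 2 * |κ| * d⁻¹ := by
              rw [← div_eq_mul_inv, le_div_iff₀ hd]
              nlinarith [abs_nonneg κ]
            gcongr
        _ = _ := by field_simp
    have e2 : ‖cvec (mixedArea q x + h • areaVec (nuS q) x)‖ ≤ C₁ + δ * C₂ := by
      refine (norm_cvec_le _).trans ((norm_add_le _ _).trans (add_le_add (h₁ x) ?_))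
      rw [norm_smul, Real.norm_eq_abs]
      have := h₂ x
      gcongr
    rw [norm_mul, Complex.norm_real, Real.norm_eq_abs, Real.rpow_neg_one]
    have e3 := hHC y
    calc |h| * ‖cvec (mixedArea q x + h • areaVec (nuS q) x) ⬝ᵥ
          (gphi κ (shift q h x - q y) ⨯₃ dens q g y)‖
        ≤ |h| * (6 * (‖cvec (mixedArea q x + h • areaVec (nuS q) x)‖ *
          ‖gphi κ (shift q h x - q y)‖ * ‖dens q g y‖)) := by
          gcongr
          exact norm_triple_le _ _ _
      _ = 6 * (‖cvec (mixedArea q x + h • areaVec (nuS q) x)‖ *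
          (|h| * ‖gphi κ (shift q h x - q y)‖) * ‖dens q g y‖) := by ring
      _ ≤ 6 * ((C₁ + δ * C₂) * ((2 * |κ| + 1 / c) / c * ‖(x : E3) - y‖⁻¹) * C) := by gcongr
      _ = _ := by ring

variable {ψ : S2 → ℂ}

/-- The part `J_q ν` of the area vector gives the normal component of the curl, and the part of
order `h` gives the deviation. -/
theorem IsParametrization.flux_shift (hq : IsParametrization q) (hg : ContinuousOn g (range q))
    {h : ℝ} {x : S2} (hx : shift q h x ∉ range q) :
    2 * (cvec (areaVec (shift q h) x) ⬝ᵥ curl (pot q κ (dens q g)) (shift q h x)) =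
      (jac q x : ℂ) * NOff q κ g h (q x) + 2 * deviation q κ g h x := by
  have h1 : deviation q κ g h x = (h : ℂ) * (cvec (mixedArea q x + h • areaVec (nuS q) x) ⬝ᵥ
      curl (pot q κ (dens q g)) (shift q h x)) := by
    rw [deviation, integral_const_mul, dotProduct_curl_pot hq.smoothExt.continuous
      (hq.continuous_dens hg) hx]
  rw [h1, hq.NOff_apply, hq.areaVec_shift, cvec_add, cvec_smul, hq.areaVec_eq, cvec_smul,
    add_dotProduct, smul_dotProduct, smul_dotProduct, smul_eq_mul, smul_eq_mul]
  ring

theorem IsParametrization.continuous_NOff (hq : IsParametrization q)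
    (hg : ContinuousOn g (range q)) {h : ℝ} (hx : ∀ x, shift q h x ∉ range q) :
    Continuous fun x => NOff q κ g h (q x) := by
  simp only [hq.NOff_apply]
  exact continuous_const.mul (Continuous.dotProduct_fin
    (continuous_cvec.comp hq.smoothExt_nuS.continuous)
    (continuous_curl_comp (hq.smoothExt_shift h).continuous fun x =>
      contDiffAt_pot hq.smoothExt.continuous (hq.continuous_dens hg) (hx x)))

/-- The identity of Stokes' theorem on a parallel surface. -/
theorem IsParametrization.integral_NOff (hq : IsParametrization q)
    (hg : ContinuousOn g (range q)) (hψ : SmoothExt ψ) {c δ : ℝ} (hb : DistBound q c δ) {h : ℝ}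
    (hh : h ∈ Icc (-δ) δ) (h0 : h ≠ 0) :
    ∫ x, (jac q x : ℂ) * NOff q κ g h (q x) * ψ x ∂dsS2 =
      ∫ x, (2 * (pot q κ (dens q g) (shift q h x) ⬝ᵥ (DcurlS2 q ψ x +
        (h : ℂ) • DcurlS2 (nuS q) ψ x)) - 2 * deviation q κ g h x * ψ x) ∂dsS2 := by
  have hqc := hq.smoothExt.continuous
  have hx := fun x => hb.notMem h0 (abs_le.mpr hh) x
  have hB := fun x => contDiffAt_pot (κ := κ) hqc (hq.continuous_dens hg) (hx x)
  have hst := stokes (hq.smoothExt_shift h) hB hψ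
  have hpot : Continuous fun x => pot q κ (dens q g) (shift q h x) :=
    continuous_iff_continuousAt.mpr fun x =>
      ContinuousAt.comp (g := pot q κ (dens q g)) (hB x).continuousAt (hq.smoothExt_shift h).continuous.continuousAt
  have hdev : Continuous fun x => deviation q κ g h x :=
    (hq.continuous_deviation (κ := κ) hg hb).comp
      (by fun_prop : Continuous fun x : S2 => ((⟨h, hh⟩ : Icc (-δ) δ), x))
  have hJ : Continuous fun x => (jac q x : ℂ) :=
    Complex.continuous_ofReal.comp hq.smoothExt_jac.continuous
  have i1 : Integrable (fun x => (jac q x : ℂ) * NOff q κ g h (q x) * ψ x) dsS2 :=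
    Continuous.integrable_dsS2 ((hJ.mul (hq.continuous_NOff hg hx)).mul hψ.continuous)
  have i2 : Integrable (fun x => 2 * deviation q κ g h x * ψ x) dsS2 :=
    Continuous.integrable_dsS2 ((continuous_const.mul hdev).mul hψ.continuous)
  have i3 : Integrable (fun x => 2 * (pot q κ (dens q g) (shift q h x) ⬝ᵥ
      DcurlS2 (shift q h) ψ x)) dsS2 :=
    Continuous.integrable_dsS2 (continuous_const.mul (Continuous.dotProduct_fin hpot
      (continuous_DcurlS2 (hq.smoothExt_shift h) hψ)))
  simp_rw [← hq.DcurlS2_shift]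
  rw [integral_sub i3 i2, integral_const_mul, ← hst, ← integral_const_mul, eq_sub_iff_add_eq,
    ← integral_add i1 i2]
  congr 1 with x
  rw [← mul_assoc, hq.flux_shift hg (hx x)]
  ring

theorem NExists.eventually_dist (hN : NExists q κ g) {ε : ℝ} (hε : 0 < ε) :
    ∀ᶠ h in 𝓝[≠] (0 : ℝ), ∀ x : S2, dist (N q κ g (q x)) (NOff q κ g h (q x)) < ε := by
  filter_upwards [Metric.tendstoUniformlyOn_iff.mp hN ε hε] with h hh x
  exact hh _ (mem_range_self x)

theorem DistBound.eventually_mem {c δ : ℝ} (hb : DistBound q c δ) :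
    ∀ᶠ h in 𝓝[≠] (0 : ℝ), h ∈ Icc (-δ) δ ∧ h ≠ 0 := by
  filter_upwards [self_mem_nhdsWithin, nhdsWithin_le_nhds
    (Icc_mem_nhds (neg_lt_zero.mpr hb.δ_pos) hb.δ_pos)] with h h1 h2
  exact ⟨h2, h1⟩

/-- A uniform limit of continuous functions; the uniformity comes from `NExists`. -/
theorem IsParametrization.continuous_N (hq : IsParametrization q) (hg : ContinuousOn g (range q))
    (hN : NExists q κ g) : Continuous fun x => N q κ g (q x) := by
  obtain ⟨c, δ, hb⟩ := hq.exists_distBound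
  refine TendstoUniformly.continuous (p := 𝓝[≠] (0 : ℝ)) (F := fun h x => NOff q κ g h (q x)) ?_ ?_
  · rw [Metric.tendstoUniformly_iff]
    exact fun ε hε => hN.eventually_dist hε
  · refine Eventually.frequently ?_
    filter_upwards [hb.eventually_mem] with h hh
    exact hq.continuous_NOff hg fun x => hb.notMem hh.2 (abs_le.mpr hh.1) x

theorem IsParametrization.tendsto_integral_NOff (hq : IsParametrization q)
    (hg : ContinuousOn g (range q)) (hψ : SmoothExt ψ) (hN : NExists q κ g) :
    Tendsto (fun h => ∫ x, (jac q x : ℂ) * NOff q κ g h (q x) * ψ x ∂dsS2) (𝓝[≠] 0)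
      (𝓝 (∫ x, (jac q x : ℂ) * N q κ g (q x) * ψ x ∂dsS2)) := by
  obtain ⟨c, δ, hb⟩ := hq.exists_distBound
  have hJ : Continuous fun x => (jac q x : ℂ) :=
    Complex.continuous_ofReal.comp hq.smoothExt_jac.continuous
  have hNc := hq.continuous_N hg hN
  have hψc := hψ.continuous
  refine tendsto_integral_filter_of_dominated_convergence
    (fun x => ‖(jac q x : ℂ)‖ * (‖N q κ g (q x)‖ + 1) * ‖ψ x‖) ?_ ?_ ?_ ?_
  · filter_upwards [hb.eventually_mem] with h hh
    exact ((hJ.mul (hq.continuous_NOff hg fun x =>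
      hb.notMem hh.2 (abs_le.mpr hh.1) x)).mul hψc).aestronglyMeasurable
  -- Uniform closeness to within `1` supplies the dominating function `|Ng| + 1`.
  · filter_upwards [hN.eventually_dist one_pos] with h hh
    refine ae_of_all _ fun x => ?_
    rw [norm_mul, norm_mul]
    have h1 : ‖NOff q κ g h (q x)‖ ≤ ‖N q κ g (q x)‖ + 1 := by
      have h2 := hh x
      rw [dist_comm, dist_eq_norm] at h2
      have := norm_sub_norm_le (NOff q κ g h (q x)) (N q κ g (q x))
      linarith
    gcongr
  · exact Continuous.integrable_dsS2 (by fun_prop)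
  · refine ae_of_all _ fun x => ?_
    have h1 : Tendsto (fun h => NOff q κ g h (q x)) (𝓝[≠] 0) (𝓝 (N q κ g (q x))) := by
      rw [Metric.tendsto_nhds]
      intro ε hε
      filter_upwards [hN.eventually_dist hε] with h hh
      rw [dist_comm]
      exact hh x
    exact (h1.const_mul _).mul_const _

/-- The weak form of the boundary operator. -/
theorem IsParametrization.integral_N (hq : IsParametrization q) (hg : ContinuousOn g (range q))
    (hψ : SmoothExt ψ) (hN : NExists q κ g) :
    ∫ x, (jac q x : ℂ) * N q κ g (q x) * ψ x ∂dsS2 =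
      ∫ x, 2 * (pot q κ (dens q g) (q x) ⬝ᵥ DcurlS2 q ψ x) ∂dsS2 := by
  obtain ⟨c, δ, hb⟩ := hq.exists_distBound
  have hδ : -δ ≤ δ := by linarith [hb.δ_pos]
  have c1 := (hq.continuous_pot_shift (κ := κ) hb (hq.continuous_dens hg)).2
  have c2 := hq.continuous_deviation (κ := κ) hg hb
  have c3 := continuous_DcurlS2 hq.smoothExt hψ
  have c4 := continuous_DcurlS2 hq.smoothExt_nuS hψ
  have c5 := hψ.continuous
  have cF : Continuous fun t : Icc (-δ) δ × S2 =>
      2 * (pot q κ (dens q g) (shift q t.1 t.2) ⬝ᵥ (DcurlS2 q ψ t.2 +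
        ((t.1 : ℝ) : ℂ) • DcurlS2 (nuS q) ψ t.2)) - 2 * deviation q κ g t.1 t.2 * ψ t.2 := by
    have c6 := Continuous.dotProduct_fin c1 (by fun_prop : Continuous fun t : Icc (-δ) δ × S2 =>
      DcurlS2 q ψ t.2 + ((t.1 : ℝ) : ℂ) • DcurlS2 (nuS q) ψ t.2)
    fun_prop
  have cI := continuous_parametric_integral_of_continuous (μ := dsS2)
    (f := fun (h : Icc (-δ) δ) (x : S2) =>
      2 * (pot q κ (dens q g) (shift q h x) ⬝ᵥ (DcurlS2 q ψ x +
        ((h : ℝ) : ℂ) • DcurlS2 (nuS q) ψ x)) - 2 * deviation q κ g h x * ψ x)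
    cF (isCompact_univ (X := S2))
  simp only [Measure.restrict_univ] at cI
  -- The right side of `integral_NOff` is continuous in `h` across `0`. Projection onto `[-δ, δ]`
  -- turns it into a function on `ℝ`, so that its value at `0` is the limit sought.
  have cP := (cI.comp (continuous_projIcc (h := hδ))).tendsto 0
  have h0 : (0 : ℝ) ∈ Icc (-δ) δ := ⟨by linarith [hb.δ_pos], hb.δ_pos.le⟩
  simp only [Function.comp_def, projIcc_of_mem hδ h0, shift_zero, Complex.ofReal_zero, zero_smul,
    add_zero, deviation_zero, mul_zero, zero_mul, sub_zero] at cP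
  refine tendsto_nhds_unique (hq.tendsto_integral_NOff hg hψ hN)
    ((cP.mono_left nhdsWithin_le_nhds).congr' ?_)
  filter_upwards [hb.eventually_mem] with h hh
  rw [hq.integral_NOff hg hψ hb hh.1 hh.2, projIcc_of_mem hδ hh.1]

end Limit

/-- The matrix `D` and the vector `x̂` are real. The sesquilinear identity therefore reduces to the
bilinear one with the conjugate of `φ` as test function. -/
theorem star_DcurlS2 (φ : S2 → ℂ) (x : S2) :
    star (DcurlS2 q φ x) = DcurlS2 q (fun x => star (φ x)) x := by
  have h1 : radialExt (fun x => star (φ x)) = fun w => star (radialExt φ w) := by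
    ext1 w
    by_cases hw : w = 0
    · simp [radialExt, hw]
    · rw [radialExt_of_ne _ hw, radialExt_of_ne _ hw]
  have h2 : ∀ i, gradS2 (fun x => star (φ x)) x i = star (gradS2 φ x i) := by
    intro i
    rw [gradS2, h1, fderiv_star]
    rfl
  ext i
  simp only [DcurlS2, curlS2, Matrix.mulVec, dotProduct, Fin.sum_univ_three, Matrix.map_apply,
    cross_apply, h2, cvec, Pi.star_apply, Matrix.cons_val_zero, Matrix.cons_val_one,
    Matrix.cons_val]
  simp

theorem IsSmooth.smoothExt_star {φ : S2 → ℂ} (hφ : IsSmooth φ) :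
    SmoothExt fun x => star (φ x) :=
  hφ.smoothExt.clm_comp (Complex.conjCLE : ℂ →L[ℝ] ℂ)

end SphereBIE

theorem theorem4p1 (q : SphereBIE.S2 → SphereBIE.E3) (hq : SphereBIE.IsParametrization q)
    (κ : ℝ) (hκ : 0 < κ) :
    -- every Hölder continuous tangential density lies in the domain of `N`
    (∀ g : SphereBIE.E3 → SphereBIE.C3, SphereBIE.IsContTangential q g →
      (∃ (C α : NNReal), 0 < α ∧ α ≤ 1 ∧ HolderOnWith C α g (Set.range q)) →
        SphereBIE.NExists q κ g) ∧
    (∀ g : SphereBIE.E3 → SphereBIE.C3, SphereBIE.IsContTangential q g →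
      -- the potential and the single-layer operator are given by convergent integrals
      (∀ z ∉ Set.range q,
        MeasureTheory.Integrable (fun y => SphereBIE.Phi κ z y • g y)
          (SphereBIE.surfaceMeasure q) ∧
        DifferentiableAt ℝ (SphereBIE.vecPotential q κ g) z) ∧
      (∀ x : SphereBIE.S2,
        MeasureTheory.Integrable (fun y => SphereBIE.singleLayerKernel q κ x y • g (q y))
          SphereBIE.dsS2) ∧
      -- the identity, on the whole domain of `N` and for all smooth test functions
      (SphereBIE.NExists q κ g →
        ∀ φ : SphereBIE.S2 → ℂ, SphereBIE.IsSmooth φ →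
          MeasureTheory.Integrable
            (fun x => ((SphereBIE.jac q x : ℂ) * SphereBIE.N q κ g (q x)) * star (φ x))
            SphereBIE.dsS2 ∧
          MeasureTheory.Integrable
            (fun x => SphereBIE.singleLayer q κ (g ∘ q) x ⬝ᵥ star (SphereBIE.DcurlS2 q φ x))
            SphereBIE.dsS2 ∧
          ∫ x, ((SphereBIE.jac q x : ℂ) * SphereBIE.N q κ g (q x)) * star (φ x) ∂SphereBIE.dsS2
            = ∫ x, SphereBIE.singleLayer q κ (g ∘ q) x ⬝ᵥ star (SphereBIE.DcurlS2 q φ x)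
                ∂SphereBIE.dsS2)) := by
  refine ⟨fun g hg ⟨A, α, hα0, hα, hH⟩ => hq.nExists_of_holder hg.1 hα0 hα hH,
    fun g hg => ⟨fun z hz => ⟨hq.integrable_Phi hg.1 hz, ?_⟩,
      fun x => SphereBIE.integrable_singleLayerKernel hq hg.1 x, fun hN φ hφ => ?_⟩⟩
  · rw [hq.vecPotential_eq]
    exact (SphereBIE.hasFDerivAt_pot hq.smoothExt.continuous
      (hq.continuous_dens hg.1) hz).differentiableAt
  · have hψ := hφ.smoothExt_star
    obtain ⟨c, δ, hb⟩ := hq.exists_distBound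
    have hpot : Continuous fun x => SphereBIE.pot q κ (SphereBIE.dens q g) (q x) := by
      have h0 : (0 : ℝ) ∈ Set.Icc (-δ) δ := ⟨by linarith [hb.δ_pos], hb.δ_pos.le⟩
      have := (hq.continuous_pot_shift (κ := κ) hb (hq.continuous_dens hg.1)).2.comp
        (by fun_prop : Continuous fun x : SphereBIE.S2 => ((⟨0, h0⟩ : Set.Icc (-δ) δ), x))
      simpa [Function.comp_def] using this
    simp only [SphereBIE.star_DcurlS2, SphereBIE.singleLayer_eq hq, smul_dotProduct, smul_eq_mul]
    refine ⟨SphereBIE.Continuous.integrable_dsS2 (((Complex.continuous_ofReal.comp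
      hq.smoothExt_jac.continuous).mul (hq.continuous_N hg.1 hN)).mul hψ.continuous),
      SphereBIE.Continuous.integrable_dsS2 (continuous_const.mul
        (SphereBIE.Continuous.dotProduct_fin hpot
          (SphereBIE.continuous_DcurlS2 hq.smoothExt hψ))), ?_⟩
    exact hq.integral_N hg.1 hψ hN
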